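/- For every $n\ge 1$ let ${\bf X}_n=(X_{ij})_{i,j=1}^n$ and ${\bf Y}_n=(Y_{ij})_{i,j=1}^n$ be independent real symmetric random matrices on a common probability space (the entries and the numbers $\sigma_{ij}$ may depend on $n$), with $\mathbb E X_{ij}=\mathbb E Y_{ij}=0$ and $\mathbb E X_{ij}^2=\mathbb E Y_{ij}^2=\sigma_{ij}^2<\infty$ for all $i,j$. For $1\le i\le j\le n$ let $\mathfrak F^{(i,j)}=\sigma\{X_{kl}: 1\le k\le l\le n,\ (k,l)\ne(i,j)\}$, and put $\mathfrak F^{(j,i)}=\mathfrak F^{(i,j)}$. Suppose that: 1. $\mathbb E(X_{ij}\mid\mathfrak F^{(i,j)})=0$ almost surely for all $n$ and all $1\le i\le j\le n$; 2. $\frac1{n^2}\sum_{i,j=1}^n\mathbb E\bigl|\mathbb E(X_{ij}^2\mid\mathfrak F^{(i,j)})-\sigma_{ij}^2\bigr|\to0$ as $n\to\infty$; 3. for every fixed $\tau>0$, $\frac1{n^2}\sum_{i,j=1}^n\mathbb E|X_{ij}|^2\mathbf 1(|X_{ij}|\ge\tau\sqrt n)\to0$ and $\frac1{n^2}\sum_{i,j=1}^n\mathbb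 E|Y_{ij}|^2\mathbf 1(|Y_{ij}|\ge\tau\sqrt n)\to0$ as $n\to\infty$; 4. with $B_i^2=\frac1n\sum_{j=1}^n\sigma_{ij}^2$, $\frac1n\sum_{i=1}^n|B_i^2-1|\to0$ as $n\to\infty$; 5. the entries $Y_{ij}$, $1\le i\le j\le n$, are independent Gaussian random variables (possibly degenerate). For a real symmetric random matrix ${\bf A}$ of size $n$ let $F^{\bf A}(x)=\mathbb E\,\frac1n\#\{i:\lambda_i\le x\}$, where $\lambda_1\le\dots\le\lambda_n$ are the eigenvalues of $n^{-1/2}{\bf A}$ counted with multiplicity, and let $$L(F_1,F_2)=\inf\{\varepsilon>0: F_1(x-\varepsilon)-\varepsilon\le F_2(x)\le F_1(x+\varepsilon)+\varepsilon\ \text{ for all }x\in\mathbb R\}$$ be the Lévy distance. Then $$L(F^{{\bf X}_n},F^{{\bf Y}_n})\to0\quad\text{as }n\to\infty .$$ -/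

import Mathlib

open MeasureTheory ProbabilityTheory Filter Topology

noncomputable section

/-- The empirical spectral distribution function
`x ↦ n⁻¹ #{i : λᵢ ≤ x}`, where `λ₁, …, λₙ` are the eigenvalues, counted with multiplicity (the
roots of the characteristic polynomial; all `n` of them are real for a real symmetric matrix), of
the rescaled matrix `n^{-1/2} A`. -/
def empiricalSpectralCDF {n : ℕ} (A : Matrix (Fin n) (Fin n) ℝ) (x : ℝ) : ℝ :=
  (Multiset.countP (fun l : ℝ => l ≤ x) ((Real.sqrt n)⁻¹ • A).charpoly.roots : ℝ) / n

/-- The expected spectral distribution function `F^X(x) = E[empirical spectral distribution]`. -/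
def expectedSpectralCDF {Ω : Type*} [MeasurableSpace Ω] (P : Measure Ω) {n : ℕ}
    (X : Ω → Matrix (Fin n) (Fin n) ℝ) (x : ℝ) : ℝ :=
  ∫ ω, empiricalSpectralCDF (X ω) x ∂P

/-- The Lévy distance between two distribution functions on the line. -/
def levyDistance (F G : ℝ → ℝ) : ℝ :=
  sInf {ε : ℝ | 0 < ε ∧ ∀ x : ℝ, F (x - ε) - ε ≤ G x ∧ G x ≤ F (x + ε) + ε}

/-- The σ-algebra generated by all entries `X k l`, `k ≤ l`, of a symmetric random matrix other
than the entry in position `(i, j)`. A position below the diagonal is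
identified with its mirror image, since `X i j = X j i`. -/
abbrev sigmaOthers {Ω : Type*} {n : ℕ} (X : Ω → Matrix (Fin n) (Fin n) ℝ) (i j : Fin n) :
    MeasurableSpace Ω :=
  ⨆ p : {p : Fin n × Fin n // p.1 ≤ p.2 ∧ p ≠ (min i j, max i j)},
    MeasurableSpace.comap (fun ω => X ω p.1.1 p.1.2) inferInstance

/-- Symmetric random matrix whose entries are random variables with
`E X i j = 0` and `E (X i j)² = (σ i j)²` (in particular square integrable). -/
structure IsCenteredSymmetric {Ω : Type*} [MeasurableSpace Ω] (P : Measure Ω) {n : ℕ}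
    (X : Ω → Matrix (Fin n) (Fin n) ℝ) (σ : Fin n → Fin n → ℝ) : Prop where
  symm : ∀ ω, (X ω).IsSymm
  measurable : ∀ i j, Measurable fun ω => X ω i j
  memLp_two : ∀ i j, MemLp (fun ω => X ω i j) 2 P
  mean : ∀ i j, ∫ ω, X ω i j ∂P = 0
  second_moment : ∀ i j, ∫ ω, (X ω i j) ^ 2 ∂P = (σ i j) ^ 2

/-- Each entry has zero conditional expectation given all the other entries. -/
def MartingaleCondition {Ω : Type*} [MeasurableSpace Ω] (P : Measure Ω) {n : ℕ}
    (X : Ω → Matrix (Fin n) (Fin n) ℝ) : Prop :=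
  ∀ i j : Fin n, i ≤ j → P[fun ω => X ω i j | sigmaOthers X i j] =ᵐ[P] 0

/-- `n⁻² ∑ i j, E |E((X i j)² | other entries) - (σ i j)²|`. -/
def condVarianceDefect {Ω : Type*} [MeasurableSpace Ω] (P : Measure Ω) {n : ℕ}
    (X : Ω → Matrix (Fin n) (Fin n) ℝ) (σ : Fin n → Fin n → ℝ) : ℝ :=
  1 / (n : ℝ) ^ 2 * ∑ i, ∑ j,
    ∫ ω, |(P[fun ω' => (X ω' i j) ^ 2 | sigmaOthers X i j]) ω - (σ i j) ^ 2| ∂P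

/-- Lindeberg's ratio `L_n(τ) = n⁻² ∑ i j, E |X i j|² 1(|X i j| ≥ τ √n)`. -/
def lindebergRatio {Ω : Type*} [MeasurableSpace Ω] (P : Measure Ω) {n : ℕ}
    (X : Ω → Matrix (Fin n) (Fin n) ℝ) (τ : ℝ) : ℝ :=
  1 / (n : ℝ) ^ 2 * ∑ i, ∑ j,
    ∫ ω in {ω | τ * Real.sqrt n ≤ |X ω i j|}, |X ω i j| ^ 2 ∂P

/-- The averaged row variance `B_i² = n⁻¹ ∑ j, (σ i j)²`. -/
def rowVariance {n : ℕ} (σ : Fin n → Fin n → ℝ) (i : Fin n) : ℝ :=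
  1 / (n : ℝ) * ∑ j, (σ i j) ^ 2

/-- The entries on and above the diagonal are independent Gaussian random variables
(degenerate, that is almost surely constant, Gaussians are allowed). -/
structure HasIndepGaussianEntries {Ω : Type*} [MeasurableSpace Ω] (P : Measure Ω) {n : ℕ}
    (Y : Ω → Matrix (Fin n) (Fin n) ℝ) : Prop where
  gaussian : ∀ i j, HasGaussianLaw (fun ω => Y ω i j) P
  indep : iIndepFun
    (fun (p : {p : Fin n × Fin n // p.1 ≤ p.2}) ω => Y ω p.1.1 p.1.2) P

end

/-! Lindeberg replacement is carried out on the Stieltjes transform at a fixed height `v`, and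
Cauchy smoothing then converts closeness of Stieltjes transforms into closeness of distribution
functions. No limit law is identified.

Pass from X to Y one upper-triangular entry at a time. As a function of one entry `t`, the
normalized imaginary resolvent trace is expanded around `t = 0` to second order, with coefficients
depending only on the other entries. The linear term vanishes in mean by conditional centering. In
the quadratic term the square of the entry may be replaced by `σ²` at the cost of the conditional
variance defect, and the resulting `σ²` terms for X and Y cancel. Perturbing one entry changes at
most two matrix positions, so taking the trace costs no factor `n`: the term of order `k` is of size
`n⁻¹ n^(-k/2) v^(-k-1)`. Splitting the remainder at `τ √n` leaves the Lindeberg ratio plus `τ` times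
the mean variance, which becomes small on letting `n → ∞` and then `τ → 0`. This is carried by
`abs_integral_sub_le_sum_swapError`, `exists_coordExpansion_imStieltjes` and
`abs_integral_imStieltjes_sub_le`.

Integrated along a horizontal segment at height `v`, the imaginary part gives the mass of an
interval under the spectral measure convolved with a Cauchy law of width `v`. This recovers the
distribution function up to a shift `ε` and the Cauchy tail beyond `ε`. The second moment of the
expected spectrum is the mean variance, eventually at most 2, so Chebyshev's inequality confines
everything to a bounded interval (`expectedSpectralCDF_le`). -/

noncomputable section

/-! ### Lindeberg replacement under conditional centering -/

/-- Integrating against a bounded `m`-measurable weight only sees the conditional expectation. -/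
theorem abs_integral_mul_le_of_measurable {Ω : Type*} {m mΩ : MeasurableSpace Ω}
    {P : Measure Ω} [IsProbabilityMeasure P] (hm : m ≤ mΩ) {g φ : Ω → ℝ}
    {C : ℝ} (hg : Integrable g P) (hφ : Measurable[m] φ) (hC : ∀ ω, |φ ω| ≤ C) :
    |∫ ω, g ω * φ ω ∂P| ≤ C * ∫ ω, |(P[g | m]) ω| ∂P := by
  have hgφ : Integrable (g * φ) P :=
    hg.mul_bdd (c := C) (hφ.mono hm le_rfl).aestronglyMeasurable (.of_forall hC)
  have h1 : P[g * φ | m] =ᵐ[P] P[g | m] * φ :=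
    condExp_mul_of_stronglyMeasurable_right hφ.stronglyMeasurable hgφ hg
  have h2 : ∫ ω, g ω * φ ω ∂P = ∫ ω, (P[g | m]) ω * φ ω ∂P := by
    rw [← integral_condExp hm (f := fun ω => g ω * φ ω)]
    exact integral_congr_ae h1
  rw [h2, ← integral_const_mul]
  refine (abs_integral_le_integral_abs).trans (integral_mono_of_nonneg
    (.of_forall fun ω => abs_nonneg _) (integrable_condExp.abs.const_mul C) (.of_forall fun ω => ?_))
  simp only [abs_mul]
  rw [mul_comm]
  exact mul_le_mul_of_nonneg_right (hC ω) (abs_nonneg _)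

/-- The weight may in addition depend on an independent random element. -/
theorem abs_integral_mul_le_of_indepFun {Ω E F : Type*} [MeasurableSpace E] [MeasurableSpace F]
    {m mΩ : MeasurableSpace Ω} {P : Measure Ω} [IsProbabilityMeasure P]
    (hm : m ≤ mΩ) {x : Ω → E} {y : Ω → F} (hx : Measurable x)
    (hy : Measurable y) (hxy : IndepFun x y P) {G : E → ℝ} (hG : Measurable G)
    (hGx : Integrable (fun ω => G (x ω)) P) {φ : E × F → ℝ} (hφ : Measurable φ) {C : ℝ}
    (hC : ∀ e, |φ e| ≤ C) (hφm : ∀ y', Measurable[m] fun ω => φ (x ω, y')) :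
    |∫ ω, G (x ω) * φ (x ω, y ω) ∂P| ≤ C * ∫ ω, |(P[fun ω => G (x ω) | m]) ω| ∂P := by
  have hmap := (indepFun_iff_map_prod_eq_prod_map_map hx.aemeasurable hy.aemeasurable).1 hxy
  have hH : Measurable fun e : E × F => G e.1 * φ e := (hG.comp measurable_fst).mul hφ
  have : IsProbabilityMeasure (P.map x) := Measure.isProbabilityMeasure_map hx.aemeasurable
  have : IsProbabilityMeasure (P.map y) := Measure.isProbabilityMeasure_map hy.aemeasurable
  have hint : Integrable (fun e : E × F => G e.1 * φ e) ((P.map x).prod (P.map y)) := by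
    rw [← hmap, integrable_map_measure hH.aestronglyMeasurable (hx.prodMk hy).aemeasurable]
    exact hGx.mul_bdd (c := C) (hφ.comp (hx.prodMk hy)).aestronglyMeasurable
      (.of_forall fun ω => hC _)
  -- By independence `y` can be frozen and integrated last; for each frozen value the weight is
  -- `m`-measurable.
  have h1 : ∫ ω, G (x ω) * φ (x ω, y ω) ∂P
      = ∫ y', ∫ ω, G (x ω) * φ (x ω, y') ∂P ∂(P.map y) := by
    have := integral_map (μ := P) (hx.prodMk hy).aemeasurable
      (hH.aestronglyMeasurable (μ := P.map fun ω => (x ω, y ω)))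
    rw [← this, hmap, integral_prod_symm _ hint]
    refine integral_congr_ae (.of_forall fun y' => ?_)
    exact integral_map hx.aemeasurable
      ((hH.comp (measurable_id.prodMk measurable_const)).aestronglyMeasurable)
  rw [h1]
  have := norm_integral_le_of_norm_le_const (μ := P.map y)
    (f := fun y' => ∫ ω, G (x ω) * φ (x ω, y') ∂P)
    (.of_forall fun y' => abs_integral_mul_le_of_measurable hm hGx (hφm y') (fun ω => hC _))
  simpa using this

/-- The vector with coordinates from `y` on `S` and from `x` off `S`. -/
def mixCoords {I : Type*} [DecidableEq I] (S : Finset I) (x y : I → ℝ) : I → ℝ :=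
  fun q => if q ∈ S then y q else x q

theorem mixCoords_empty {I : Type*} [DecidableEq I] (x y : I → ℝ) : mixCoords ∅ x y = x := by
  ext q; simp [mixCoords]

theorem mixCoords_univ {I : Type*} [Fintype I] [DecidableEq I] (x y : I → ℝ) :
    mixCoords Finset.univ x y = y := by
  ext q; simp [mixCoords]

theorem mixCoords_compl {I : Type*} [Fintype I] [DecidableEq I] (S : Finset I) (x y : I → ℝ) :
    mixCoords Sᶜ y x = mixCoords S x y := by
  ext q; by_cases h : q ∈ S <;> simp [mixCoords, h]

theorem measurable_mixCoords {I : Type*} [DecidableEq I] (S : Finset I) :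
    Measurable fun e : (I → ℝ) × (I → ℝ) => mixCoords S e.1 e.2 := by
  refine measurable_pi_lambda _ fun q => ?_
  by_cases h : q ∈ S <;> simp only [mixCoords, h, if_true, if_false] <;> fun_prop

/-- The bound on the error made in replacing one coordinate: variance defect and Lindeberg terms. -/
def swapError {Ω : Type*} (m : MeasurableSpace Ω) {mΩ : MeasurableSpace Ω} (P : Measure Ω)
    (ξ : Ω → ℝ) (s T C₂ C₃ : ℝ) : ℝ :=
  C₂ * (∫ ω, |(P[fun ω => ξ ω ^ 2 | m]) ω - s| ∂P + ∫ ω in {ω | T ≤ |ξ ω|}, |ξ ω| ^ 2 ∂P)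
    + C₃ * T * ∫ ω, ξ ω ^ 2 ∂P

/-- `f` has a second order expansion at `0` in coordinate `p` with remainder controlled by
`C₂ t²` and by `C₃ |t|³`. -/
structure CoordExpansion {I : Type*} [DecidableEq I] (f a b : (I → ℝ) → ℝ) (p : I)
    (C₁ C₂ C₃ : ℝ) : Prop where
  measurable_fst : Measurable a
  measurable_snd : Measurable b
  bound_fst : ∀ w, |a w| ≤ C₁
  bound_snd : ∀ w, |b w| ≤ C₂
  remainder_sq : ∀ w, w p = 0 → ∀ t : ℝ,
    |f (Function.update w p t) - f w - t * a w - t ^ 2 * b w| ≤ C₂ * t ^ 2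
  remainder_cube : ∀ w, w p = 0 → ∀ t : ℝ,
    |f (Function.update w p t) - f w - t * a w - t ^ 2 * b w| ≤ C₃ * |t| ^ 3

/-- Expanding around the vector with coordinate `p` set to `0` makes the weights `a` and `b`
independent of `x p`, so conditioning on the other coordinates removes the linear term and turns the
square into `s` up to the variance defect. The main term `s * ∫ b` involves only the zeroed hybrid,
hence is the same whichever vector supplies coordinate `p`. -/
theorem abs_integral_update_sub_le {Ω I : Type*} [Fintype I] [DecidableEq I]
    {m mΩ : MeasurableSpace Ω} {P : Measure Ω} [IsProbabilityMeasure P]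
    {x y : Ω → I → ℝ} (hx : Measurable x) (hy : Measurable y)
    (hxy : IndepFun x y P) {p : I} (hL2 : MemLp (fun ω => x ω p) 2 P)
    (hm : m ≤ mΩ) (hmq : ∀ q, q ≠ p → Measurable[m] fun ω => x ω q)
    (hmart : P[fun ω => x ω p | m] =ᵐ[P] 0) {f a b : (I → ℝ) → ℝ} (hf : Measurable f)
    {C₀ C₁ C₂ C₃ : ℝ} (hf0 : ∀ w, |f w| ≤ C₀) (hab : CoordExpansion f a b p C₁ C₂ C₃)
    (hC₃ : 0 ≤ C₃) (S : Finset I) (s : ℝ) {T : ℝ} (hT : 0 ≤ T) :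
    |∫ ω, f (Function.update (mixCoords S (x ω) (y ω)) p (x ω p)) ∂P
      - ∫ ω, f (Function.update (mixCoords S (x ω) (y ω)) p 0) ∂P
      - s * ∫ ω, b (Function.update (mixCoords S (x ω) (y ω)) p 0) ∂P|
      ≤ swapError m P (fun ω => x ω p) s T C₂ C₃ := by
  set ψ : (I → ℝ) × (I → ℝ) → (I → ℝ) :=
    fun e => Function.update (mixCoords S e.1 e.2) p 0 with hψ
  have hψm : Measurable ψ := by
    refine measurable_pi_lambda _ fun q => ?_
    by_cases h : q = p
    · subst h; simp [hψ]
    · simp only [hψ, Function.update_of_ne h]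
      exact (measurable_pi_apply q).comp (measurable_mixCoords S)
  have hψx : ∀ y', Measurable[m] fun ω => ψ (x ω, y') := by
    intro y'
    refine @measurable_pi_lambda _ _ _ m _ _ fun q => ?_
    by_cases h : q = p
    · subst h; simp [hψ]
    · simp only [hψ, Function.update_of_ne h, mixCoords]
      by_cases hS : q ∈ S
      · simp [hS]
      · simpa [hS] using hmq q h
  have hxym : Measurable fun ω => (x ω, y ω) := hx.prodMk hy
  have hxp : Measurable fun ω => x ω p := (measurable_pi_apply p).comp hx
  have hint1 : Integrable (fun ω => x ω p) P := hL2.integrable (by norm_num)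
  have hint2 : Integrable (fun ω => x ω p ^ 2) P := hL2.integrable_sq
  have hC₂ : 0 ≤ C₂ := (abs_nonneg _).trans (hab.bound_snd 0)
  set U : Ω → I → ℝ := fun ω => ψ (x ω, y ω) with hU
  have hUm : Measurable U := hψm.comp hxym
  have hA : ∫ ω, x ω p * a (U ω) ∂P = 0 := by
    have := abs_integral_mul_le_of_indepFun hm hx hy hxy (measurable_pi_apply p) hint1
      (hab.measurable_fst.comp hψm) (fun e => hab.bound_fst _)
      (fun y' => hab.measurable_fst.comp (hψx y'))
    have h0 : ∫ ω, |(P[fun ω => x ω p | m]) ω| ∂P = 0 := by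
      rw [integral_eq_zero_of_ae]
      filter_upwards [hmart] with ω h
      simp [h]
    rw [h0, mul_zero] at this
    exact abs_nonpos_iff.1 this
  have hB : |∫ ω, (x ω p ^ 2 - s) * b (U ω) ∂P|
      ≤ C₂ * ∫ ω, |(P[fun ω => x ω p ^ 2 | m]) ω - s| ∂P := by
    have := abs_integral_mul_le_of_indepFun hm hx hy hxy (G := fun w => w p ^ 2 - s)
      (by fun_prop) (hint2.sub (integrable_const s))
      (hab.measurable_snd.comp hψm) (fun e => hab.bound_snd _)
      (fun y' => hab.measurable_snd.comp (hψx y'))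
    refine this.trans_eq ?_
    congr 1
    refine integral_congr_ae ?_
    have h := condExp_sub hint2 (integrable_const s) m
    rw [condExp_const hm] at h
    filter_upwards [h] with ω h
    exact congrArg abs h
  set R : Ω → ℝ := fun ω => f (Function.update (U ω) p (x ω p)) - f (U ω) - x ω p * a (U ω)
    - x ω p ^ 2 * b (U ω) with hR
  have hUp : ∀ ω, U ω p = 0 := fun ω => by simp [hU, hψ]
  have hset : MeasurableSet {ω | T ≤ |x ω p|} := measurableSet_le measurable_const hxp.abs
  -- Above the threshold `T` the quadratic bound is used; below it the cubic one, with `|t|³ ≤ T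
  -- t²`.
  have hRle : ∀ ω, |R ω| ≤ C₂ * Set.indicator {ω | T ≤ |x ω p|} (fun ω => |x ω p| ^ 2) ω
      + C₃ * T * x ω p ^ 2 := by
    intro ω
    by_cases h : T ≤ |x ω p|
    · have := hab.remainder_sq _ (hUp ω) (x ω p)
      rw [Set.indicator_of_mem (by exact h), sq_abs]
      have : 0 ≤ C₃ * T * x ω p ^ 2 := by positivity
      linarith
    · have := hab.remainder_cube _ (hUp ω) (x ω p)
      rw [Set.indicator_of_notMem (by exact h)]
      push Not at h
      have h2 : |x ω p| ^ 3 ≤ T * x ω p ^ 2 := by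
        rw [pow_succ', sq_abs]
        exact mul_le_mul_of_nonneg_right h.le (sq_nonneg _)
      have := mul_le_mul_of_nonneg_left h2 hC₃
      linarith
  have hfm : ∀ g : (I → ℝ) → ℝ, Measurable g → ∀ C, (∀ w, |g w| ≤ C) → ∀ V : Ω → I → ℝ,
      Measurable V → Integrable (fun ω => g (V ω)) P := fun g hg C hC V hV =>
    Integrable.of_bound (hg.comp hV).aestronglyMeasurable C (.of_forall fun ω => hC _)
  have hVm : Measurable fun ω => Function.update (U ω) p (x ω p) := by
    refine measurable_pi_lambda _ fun q => ?_
    by_cases h : q = p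
    · subst h; simpa using hxp
    · simp only [Function.update_of_ne h]
      exact (measurable_pi_apply q).comp hUm
  have i1 := hfm f hf C₀ hf0 _ hVm
  have i2 := hfm f hf C₀ hf0 _ hUm
  have i3 : Integrable (fun ω => x ω p * a (U ω)) P :=
    hint1.mul_bdd (c := C₁) (hab.measurable_fst.comp hUm).aestronglyMeasurable
      (.of_forall fun ω => hab.bound_fst _)
  have i4 : Integrable (fun ω => x ω p ^ 2 * b (U ω)) P :=
    hint2.mul_bdd (c := C₂) (hab.measurable_snd.comp hUm).aestronglyMeasurable
      (.of_forall fun ω => hab.bound_snd _)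
  have i5 := hfm b hab.measurable_snd C₂ hab.bound_snd _ hUm
  have hRint : ∫ ω, R ω ∂P = ∫ ω, f (Function.update (U ω) p (x ω p)) ∂P - ∫ ω, f (U ω) ∂P
      - ∫ ω, x ω p * a (U ω) ∂P - ∫ ω, x ω p ^ 2 * b (U ω) ∂P := by
    simp only [hR]
    rw [integral_sub ?_ i4, integral_sub ?_ i3, integral_sub i1 i2]
    · exact i1.sub i2
    · exact (i1.sub i2).sub i3
  have hBs : ∫ ω, (x ω p ^ 2 - s) * b (U ω) ∂P
      = ∫ ω, x ω p ^ 2 * b (U ω) ∂P - s * ∫ ω, b (U ω) ∂P := by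
    simp_rw [sub_mul]
    rw [integral_sub i4 (i5.const_mul s), integral_const_mul]
  have hsqi : Integrable (fun ω => |x ω p| ^ 2) P := by simpa only [sq_abs] using hint2
  have hRb : |∫ ω, R ω ∂P| ≤ C₂ * ∫ ω in {ω | T ≤ |x ω p|}, |x ω p| ^ 2 ∂P
      + C₃ * T * ∫ ω, x ω p ^ 2 ∂P := by
    rw [← integral_indicator hset (f := fun ω => |x ω p| ^ 2), ← integral_const_mul,
      ← integral_const_mul, ← integral_add]
    · exact abs_integral_le_integral_abs.trans (integral_mono_of_nonneg
        (.of_forall fun ω => abs_nonneg _) (((hsqi.indicator hset).const_mul _).add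
          (hint2.const_mul _)) (.of_forall hRle))
    · exact (hsqi.indicator hset).const_mul _
    · exact hint2.const_mul _
  have hUU : ∀ ω, Function.update (mixCoords S (x ω) (y ω)) p (x ω p)
      = Function.update (U ω) p (x ω p) := fun ω => by simp [hU, hψ]
  simp_rw [hUU]
  change |∫ ω, f (Function.update (U ω) p (x ω p)) ∂P - ∫ ω, f (U ω) ∂P - s * ∫ ω, b (U ω) ∂P| ≤ _
  have : ∫ ω, f (Function.update (U ω) p (x ω p)) ∂P - ∫ ω, f (U ω) ∂P - s * ∫ ω, b (U ω) ∂P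
      = ∫ ω, R ω ∂P + ∫ ω, (x ω p ^ 2 - s) * b (U ω) ∂P := by
    rw [hRint, hBs, hA]; ring
  rw [this, swapError]
  have := abs_add_le (∫ ω, R ω ∂P) (∫ ω, (x ω p ^ 2 - s) * b (U ω) ∂P)
  linarith

/-- Conditions on the coordinates of a random vector `x` under which coordinates can be swapped:
they are square integrable and conditionally centered given a σ-algebra that sees all others. -/
structure SwapVector {Ω I : Type*} [mΩ : MeasurableSpace Ω] (P : Measure Ω) (x : Ω → I → ℝ)
    (m : I → MeasurableSpace Ω) : Prop where
  measurable : Measurable x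
  memLp : ∀ p, MemLp (fun ω => x ω p) 2 P
  le : ∀ p, m p ≤ mΩ
  measurable_other : ∀ p q, q ≠ p → Measurable[m p] fun ω => x ω q
  condExp_eq_zero : ∀ p, P[fun ω => x ω p | m p] =ᵐ[P] 0

/-- **Lindeberg's replacement principle** for vectors with conditionally centered coordinates. -/
theorem abs_integral_sub_le_sum_swapError {Ω I : Type*} [Fintype I] [DecidableEq I]
    [MeasurableSpace Ω] {P : Measure Ω} [IsProbabilityMeasure P]
    {x y : Ω → I → ℝ} {mx my : I → MeasurableSpace Ω}
    (hx : SwapVector P x mx) (hy : SwapVector P y my) (hxy : IndepFun x y P)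
    {f : (I → ℝ) → ℝ} {a b : I → (I → ℝ) → ℝ} (hf : Measurable f)
    {C₀ C₁ C₂ C₃ : ℝ} (hf0 : ∀ w, |f w| ≤ C₀) (hab : ∀ p, CoordExpansion f (a p) (b p) p C₁ C₂ C₃)
    (hC₃ : 0 ≤ C₃) (s : I → ℝ) {T : ℝ} (hT : 0 ≤ T) :
    |∫ ω, f (x ω) ∂P - ∫ ω, f (y ω) ∂P| ≤
      ∑ p, (swapError (mx p) P (fun ω => x ω p) (s p) T C₂ C₃
        + swapError (my p) P (fun ω => y ω p) (s p) T C₂ C₃) := by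
  have key : ∀ S : Finset I, |∫ ω, f (x ω) ∂P - ∫ ω, f (mixCoords S (x ω) (y ω)) ∂P| ≤
      ∑ p ∈ S, (swapError (mx p) P (fun ω => x ω p) (s p) T C₂ C₃
        + swapError (my p) P (fun ω => y ω p) (s p) T C₂ C₃) := by
    intro S
    induction S using Finset.induction_on with
    | empty => simp [mixCoords_empty]
    | insert p S hp ih =>
      have h1 := abs_integral_update_sub_le hx.measurable hy.measurable hxy (hx.memLp p) (hx.le p)
        (hx.measurable_other p) (hx.condExp_eq_zero p) hf hf0 (hab p) hC₃ S (s p) hT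
      -- With the roles of `x` and `y` exchanged, the complement of `S` gives the same hybrid
      -- vector, so the zeroed integrals and the `s`-terms of `h1` and `h2` cancel.
      have h2 := abs_integral_update_sub_le hy.measurable hx.measurable hxy.symm (hy.memLp p)
        (hy.le p) (hy.measurable_other p) (hy.condExp_eq_zero p) hf hf0 (hab p) hC₃ Sᶜ (s p) hT
      simp_rw [mixCoords_compl] at h2
      have e1 : ∀ ω, Function.update (mixCoords S (x ω) (y ω)) p (x ω p)
          = mixCoords S (x ω) (y ω) := fun ω => by
        rw [Function.update_eq_self_iff]; simp [mixCoords, hp]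
      have e2 : ∀ ω, Function.update (mixCoords S (x ω) (y ω)) p (y ω p)
          = mixCoords (insert p S) (x ω) (y ω) := fun ω => by
        ext q
        by_cases h : q = p
        · subst h; simp [mixCoords]
        · simp [mixCoords, h]
      simp_rw [e1] at h1
      simp_rw [e2] at h2
      rw [Finset.sum_insert hp]
      rw [abs_le] at h1 h2 ih ⊢
      constructor <;> linarith [h1.1, h1.2, h2.1, h2.2, ih.1, ih.2]
  simpa [mixCoords_univ] using key Finset.univ

/-! ### Operator norms of matrix units -/

section Norm

open scoped Matrix.Norms.L2Operator

variable {n : ℕ}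

theorem norm_entry_le_l2_opNorm (M : Matrix (Fin n) (Fin n) ℂ) (i j : Fin n) :
    ‖M i j‖ ≤ ‖M‖ := by
  have h := Matrix.l2_opNorm_mulVec M (EuclideanSpace.single j 1)
  have h2 := PiLp.norm_apply_le
    (WithLp.toLp 2 (M.mulVec (Pi.single j 1)) : EuclideanSpace ℂ (Fin n)) i
  simp only [Matrix.mulVec_single_one, Matrix.col_apply] at h2
  refine h2.trans ?_
  simpa using h

theorem l2_opNorm_single_one_le (i j : Fin n) :
    ‖(Matrix.single i j 1 : Matrix (Fin n) (Fin n) ℂ)‖ ≤ 1 := by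
  have h := Matrix.l2_opNorm_conjTranspose_mul_self (Matrix.single i j (1 : ℂ))
  rw [Matrix.conjTranspose_single, Matrix.single_mul_single_same, star_one, one_mul,
    ← Matrix.diagonal_single, Matrix.l2_opNorm_diagonal, Pi.norm_single, norm_one] at h
  nlinarith [norm_nonneg (Matrix.single i j (1 : ℂ))]

end Norm

/-! ### Resolvents of real symmetric matrices -/

/-- The resolvent `(A - z)⁻¹` of a real matrix at a complex point. -/
def complexResolvent {n : ℕ} (A : Matrix (Fin n) (Fin n) ℝ) (z : ℂ) : Matrix (Fin n) (Fin n) ℂ :=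
  (A.map Complex.ofReal - z • (1 : Matrix (Fin n) (Fin n) ℂ))⁻¹

section Resolvent

variable {n : ℕ} {A B : Matrix (Fin n) (Fin n) ℝ} {z : ℂ}

/-- One family of real `μ` serves both the complex resolvent and the roots of the real
characteristic polynomial; the factorization of the latter is checked over `ℂ` and pulled back by
injectivity. -/
theorem exists_unitary_diagonalization (hA : A.IsSymm) :
    ∃ (U : Matrix.unitaryGroup (Fin n) ℂ) (μ : Fin n → ℝ),
      A.map Complex.ofReal = U.1 * Matrix.diagonal (fun i => (μ i : ℂ)) * star U.1 ∧
      A.charpoly.roots = Finset.univ.val.map μ := by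
  have hC : (A.map Complex.ofReal).IsHermitian := by
    ext i j
    simp [Matrix.conjTranspose_apply, hA.apply i j]
  refine ⟨hC.eigenvectorUnitary, hC.eigenvalues, ?_, ?_⟩
  · conv_lhs => rw [hC.spectral_theorem, Unitary.conjStarAlgAut_apply]
    rfl
  · have h := hC.charpoly_eq
    have h1 : A.charpoly = ∏ i, (Polynomial.X - Polynomial.C (hC.eigenvalues i)) := by
      apply Polynomial.map_injective Complex.ofRealHom Complex.ofRealHom.injective
      rw [← Matrix.charpoly_map]
      refine h.trans ?_
      simp [Polynomial.map_prod]
    rw [h1, Polynomial.roots_prod]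
    · simp
    · simp [Finset.prod_ne_zero_iff, Polynomial.X_sub_C_ne_zero]

theorem ofReal_sub_ne_zero (hz : z.im ≠ 0) (t : ℝ) : (t : ℂ) - z ≠ 0 := by
  intro h
  apply hz
  have := congrArg Complex.im h
  simpa using this

theorem sub_smul_one_mul_of_diagonalization (hz : z.im ≠ 0) {U : Matrix.unitaryGroup (Fin n) ℂ}
    {μ : Fin n → ℝ} (h : A.map Complex.ofReal
      = U.1 * Matrix.diagonal (fun i => (μ i : ℂ)) * star U.1) :
    (A.map Complex.ofReal - z • (1 : Matrix (Fin n) (Fin n) ℂ)) *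
      (U.1 * Matrix.diagonal (fun i => ((μ i : ℂ) - z)⁻¹) * star U.1) = 1 := by
  have h1 : A.map Complex.ofReal - z • (1 : Matrix (Fin n) (Fin n) ℂ)
      = U.1 * Matrix.diagonal (fun i => (μ i : ℂ) - z) * star U.1 := by
    have : Matrix.diagonal (fun i => (μ i : ℂ) - z)
        = Matrix.diagonal (fun i => (μ i : ℂ)) - z • 1 := by
      rw [Matrix.smul_one_eq_diagonal, Matrix.diagonal_sub]
    rw [this, h, mul_sub, sub_mul]
    simp
  rw [h1]
  calc _ = U.1 * Matrix.diagonal (fun i => (μ i : ℂ) - z)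
        * (star U.1 * U) * Matrix.diagonal (fun i => ((μ i : ℂ) - z)⁻¹)
        * star U.1 := by simp only [mul_assoc]
    _ = 1 := by
      rw [Unitary.coe_star_mul_self, mul_one, mul_assoc U.1,
        Matrix.diagonal_mul_diagonal]
      simp [mul_inv_cancel₀ (ofReal_sub_ne_zero hz _)]

theorem complexResolvent_eq_of_diagonalization (hz : z.im ≠ 0)
    {U : Matrix.unitaryGroup (Fin n) ℂ} {μ : Fin n → ℝ} (h : A.map Complex.ofReal
      = U.1 * Matrix.diagonal (fun i => (μ i : ℂ)) * star U.1) :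
    complexResolvent A z
      = U.1 * Matrix.diagonal (fun i => ((μ i : ℂ) - z)⁻¹) * star U.1 :=
  Matrix.inv_eq_right_inv (sub_smul_one_mul_of_diagonalization hz h)

theorem isUnit_det_sub_smul_one (hA : A.IsSymm) (hz : z.im ≠ 0) :
    IsUnit (A.map Complex.ofReal - z • (1 : Matrix (Fin n) (Fin n) ℂ)).det := by
  obtain ⟨U, μ, h, -⟩ := exists_unitary_diagonalization hA
  exact Matrix.isUnit_det_of_right_inverse (sub_smul_one_mul_of_diagonalization hz h)

open scoped Matrix.Norms.L2Operator in
theorem norm_complexResolvent_le (hA : A.IsSymm) (hz : 0 < z.im) :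
    ‖complexResolvent A z‖ ≤ z.im⁻¹ := by
  obtain ⟨U, μ, h, -⟩ := exists_unitary_diagonalization hA
  rw [complexResolvent_eq_of_diagonalization hz.ne' h, ← Unitary.coe_star,
    CStarRing.norm_mul_coe_unitary, CStarRing.norm_coe_unitary_mul, Matrix.l2_opNorm_diagonal,
    pi_norm_le_iff_of_nonneg (by positivity)]
  intro i
  rw [norm_inv]
  refine inv_anti₀ hz ?_
  have := Complex.abs_im_le_norm ((μ i : ℂ) - z)
  simpa [abs_of_pos hz] using this

theorem trace_complexResolvent (hA : A.IsSymm) (hz : z.im ≠ 0) :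
    (complexResolvent A z).trace = (A.charpoly.roots.map fun t : ℝ => ((t : ℂ) - z)⁻¹).sum := by
  obtain ⟨U, μ, h, h2⟩ := exists_unitary_diagonalization hA
  rw [complexResolvent_eq_of_diagonalization hz h, h2, Matrix.trace_mul_comm, ← mul_assoc,
    Unitary.coe_star_mul_self, one_mul, Matrix.trace_diagonal, Multiset.map_map]
  rfl

/-- The second resolvent identity, the source of the expansions in a single entry. -/
theorem complexResolvent_sub (hA : A.IsSymm) (hB : B.IsSymm) (hz : z.im ≠ 0) :
    complexResolvent A z = complexResolvent B z
      - complexResolvent A z * (A.map Complex.ofReal - B.map Complex.ofReal)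
        * complexResolvent B z := by
  have h1 := Matrix.nonsing_inv_mul _ (isUnit_det_sub_smul_one hA hz)
  have h2 := Matrix.mul_nonsing_inv _ (isUnit_det_sub_smul_one hB hz)
  have h3 : A.map Complex.ofReal - B.map Complex.ofReal
      = (A.map Complex.ofReal - z • (1 : Matrix (Fin n) (Fin n) ℂ))
        - (B.map Complex.ofReal - z • (1 : Matrix (Fin n) (Fin n) ℂ)) := by abel
  rw [h3, mul_sub, sub_mul, complexResolvent, h1, one_mul, mul_assoc, complexResolvent, h2]
  simp

theorem continuous_complexResolvent {T : Type*} [TopologicalSpace T]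
    {A : T → Matrix (Fin n) (Fin n) ℝ} {z : T → ℂ} (hA : Continuous A) (hz : Continuous z)
    (hs : ∀ t, (A t).IsSymm) (hz0 : ∀ t, (z t).im ≠ 0) :
    Continuous fun t => complexResolvent (A t) (z t) := by
  have hM : Continuous fun t =>
      (A t).map Complex.ofReal - z t • (1 : Matrix (Fin n) (Fin n) ℂ) :=
    (hA.matrix_map Complex.continuous_ofReal).sub (hz.smul continuous_const)
  simp only [complexResolvent, Matrix.inv_def, Ring.inverse_eq_inv']
  exact (hM.matrix_det.inv₀ fun t => (isUnit_det_sub_smul_one (hs t) (hz0 t)).ne_zero).smul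
    hM.matrix_adjugate

end Resolvent

/-! ### Symmetric matrices parametrized by their upper entries -/

/-- Positions on and above the diagonal. -/
abbrev UpperIndex (n : ℕ) := {p : Fin n × Fin n // p.1 ≤ p.2}

/-- The symmetric matrix with prescribed entries on and above the diagonal. -/
def symmetricMatrix {n : ℕ} (w : UpperIndex n → ℝ) : Matrix (Fin n) (Fin n) ℝ :=
  Matrix.of fun i j => w ⟨(min i j, max i j), min_le_max⟩

section SymmetricMatrix

variable {n : ℕ}

theorem isSymm_symmetricMatrix (w : UpperIndex n → ℝ) : (symmetricMatrix w).IsSymm := by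
  ext i j
  simp [symmetricMatrix, min_comm i j, max_comm i j]

theorem symmetricMatrix_eq_of_isSymm {A : Matrix (Fin n) (Fin n) ℝ} (hA : A.IsSymm) :
    symmetricMatrix (fun p => A p.1.1 p.1.2) = A := by
  ext i j
  rcases le_total i j with h | h
  · simp [symmetricMatrix, h]
  · simp [symmetricMatrix, h, hA.apply i j]

theorem symmetricMatrix_update (w : UpperIndex n → ℝ) (p : UpperIndex n) (hw : w p = 0) (t : ℝ) :
    symmetricMatrix (Function.update w p t)
      = symmetricMatrix w + t • symmetricMatrix (Pi.single p 1) := by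
  ext i j
  simp only [symmetricMatrix, Matrix.of_apply, Matrix.add_apply, Matrix.smul_apply, smul_eq_mul]
  by_cases h : (⟨(min i j, max i j), min_le_max⟩ : UpperIndex n) = p
  · rw [h]; simp [hw]
  · simp [Function.update_of_ne h, Pi.single_eq_of_ne h]

theorem symmetricMatrix_single (p : UpperIndex n) :
    (symmetricMatrix (Pi.single p 1)).map Complex.ofReal
      = Matrix.single p.1.1 p.1.2 1
        + if p.1.1 = p.1.2 then 0 else Matrix.single p.1.2 p.1.1 1 := by
  obtain ⟨⟨k, l⟩, hkl⟩ := p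
  ext i j
  simp only [symmetricMatrix, Matrix.map_apply, Matrix.of_apply, Matrix.add_apply,
    Pi.single_apply, Subtype.mk.injEq, Prod.mk.injEq, Matrix.single_apply]
  by_cases h : k = l
  · subst h
    rcases le_total i j with hij | hij <;>
    · simp [hij, @eq_comm _ k]
      try split_ifs <;> simp_all
  · have hlt : k < l := lt_of_le_of_ne hkl h
    rcases le_total i j with hij | hij
    · have : ¬ (l = i ∧ k = j) := by rintro ⟨rfl, rfl⟩; exact absurd hlt (not_lt.2 hij)
      simp only [hij, h, min_eq_left, max_eq_right, if_false, Matrix.single_apply, this, add_zero,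
        apply_ite Complex.ofReal, Complex.ofReal_one, Complex.ofReal_zero]
      split_ifs <;> grind
    · have : ¬ (k = i ∧ l = j) := by rintro ⟨rfl, rfl⟩; exact absurd hlt (not_lt.2 hij)
      simp only [hij, h, min_eq_right, max_eq_left, if_false, Matrix.single_apply, this, zero_add,
        apply_ite Complex.ofReal, Complex.ofReal_one, Complex.ofReal_zero]
      split_ifs <;> grind

open scoped Matrix.Norms.L2Operator in
-- The perturbation direction has at most two nonzero positions, and the trace against a matrix unit
-- is a single entry of `M`. The bound is therefore free of `n`.
theorem norm_trace_mul_symmetricMatrix_single_le (M : Matrix (Fin n) (Fin n) ℂ)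
    (p : UpperIndex n) :
    ‖(M * (symmetricMatrix (Pi.single p 1)).map Complex.ofReal).trace‖ ≤ 2 * ‖M‖ := by
  have h : ∀ i j : Fin n, ‖(M * Matrix.single i j 1).trace‖ ≤ ‖M‖ := by
    intro i j
    rw [Matrix.trace_mul_single]
    simpa using norm_entry_le_l2_opNorm M j i
  rw [symmetricMatrix_single, mul_add, Matrix.trace_add, two_mul]
  refine (norm_add_le _ _).trans (add_le_add (h _ _) ?_)
  split_ifs
  · simp
  · exact h _ _

open scoped Matrix.Norms.L2Operator in
theorem norm_symmetricMatrix_single_le (p : UpperIndex n) :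
    ‖(symmetricMatrix (Pi.single p 1)).map Complex.ofReal‖ ≤ 2 := by
  rw [symmetricMatrix_single, ← one_add_one_eq_two]
  refine (norm_add_le _ _).trans (add_le_add (l2_opNorm_single_one_le _ _) ?_)
  split_ifs
  · simp
  · exact l2_opNorm_single_one_le _ _

theorem continuous_symmetricMatrix : Continuous (symmetricMatrix : (UpperIndex n → ℝ) → _) :=
  continuous_matrix fun _ _ => continuous_apply _

end SymmetricMatrix

/-! ### The Stieltjes transform and its expansion in one entry -/

/-- The imaginary part of the Stieltjes transform of the spectrum of `n^{-1/2} A`. -/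
def imStieltjes {n : ℕ} (z : ℂ) (A : Matrix (Fin n) (Fin n) ℝ) : ℝ :=
  (n : ℝ)⁻¹ * (complexResolvent ((Real.sqrt n)⁻¹ • A) z).trace.im

section ImStieltjes

variable {n : ℕ}

theorem continuous_imStieltjes {T : Type*} [TopologicalSpace T]
    {A : T → Matrix (Fin n) (Fin n) ℝ} {z : T → ℂ} (hA : Continuous A) (hz : Continuous z)
    (hs : ∀ t, (A t).IsSymm) (hz0 : ∀ t, (z t).im ≠ 0) :
    Continuous fun t => imStieltjes (z t) (A t) := by
  have hA' : Continuous fun t => (Real.sqrt n)⁻¹ • A t :=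
    continuous_matrix fun i j => continuous_const.mul (hA.matrix_elem i j)
  have h := continuous_complexResolvent hA' hz (fun t => (hs t).smul _) hz0
  exact continuous_const.mul (Complex.continuous_im.comp h.matrix_trace)

open scoped Matrix.Norms.L2Operator in
theorem abs_imStieltjes_le {z : ℂ} (hz : 0 < z.im) {A : Matrix (Fin n) (Fin n) ℝ}
    (hA : A.IsSymm) : |imStieltjes z A| ≤ z.im⁻¹ := by
  have h : ‖(complexResolvent ((Real.sqrt n)⁻¹ • A) z).trace‖ ≤ n * z.im⁻¹ := by
    refine (norm_sum_le_of_le (n := fun _ => z.im⁻¹) Finset.univ fun i _ => ?_).trans (by simp)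
    exact (norm_entry_le_l2_opNorm _ i i).trans (norm_complexResolvent_le (hA.smul _) hz)
  rw [imStieltjes, abs_mul, abs_of_nonneg (by positivity)]
  calc _ ≤ (n : ℝ)⁻¹ * (n * z.im⁻¹) :=
        mul_le_mul_of_nonneg_left ((Complex.abs_im_le_norm _).trans h) (by positivity)
    _ = ((n : ℝ)⁻¹ * n) * z.im⁻¹ := by ring
    _ ≤ 1 * z.im⁻¹ := mul_le_mul_of_nonneg_right inv_mul_le_one (by positivity)
    _ = _ := one_mul _

section Expansion

variable {A B R₀ R₁ D : Matrix (Fin n) (Fin n) ℂ} {v : ℝ}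

/-- The resolvent identity is substituted into itself. Keeping `R₁` in the last term makes the
identity exact, with no smallness of `s` needed. -/
theorem resolvent_expansion_two {s : ℂ} (h : R₁ = R₀ - s • (R₁ * D * R₀)) :
    R₁ = R₀ - s • (R₀ * D * R₀) + s ^ 2 • (R₁ * D * R₀ * D * R₀) := by
  have h3 : R₁ * D * R₀ = R₀ * D * R₀ - s • (R₁ * D * R₀ * D * R₀) := by
    nth_rewrite 1 [h]
    simp only [sub_mul, smul_mul_assoc]
  rw [h3] at h
  refine h.trans ?_
  rw [smul_sub, smul_smul, sub_add, sq]

theorem resolvent_expansion_three {s : ℂ} (h : R₁ = R₀ - s • (R₁ * D * R₀)) :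
    R₁ = R₀ - s • (R₀ * D * R₀) + s ^ 2 • (R₀ * D * R₀ * D * R₀)
      - s ^ 3 • (R₁ * D * R₀ * D * R₀ * D * R₀) := by
  have h3 : R₁ * D * R₀ * D * R₀
      = R₀ * D * R₀ * D * R₀ - s • (R₁ * D * R₀ * D * R₀ * D * R₀) := by
    nth_rewrite 1 [h]
    simp only [sub_mul, smul_mul_assoc]
  have h2 := resolvent_expansion_two h
  rw [h3] at h2
  refine h2.trans ?_
  rw [smul_sub, smul_smul, ← pow_succ, add_sub_assoc]

open scoped Matrix.Norms.L2Operator in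
-- Cyclicity moves one `D` to the end, where the trace bound absorbs it; the remaining factors are
-- bounded in operator norm. With `k` copies of `D` there are `k + 1` resolvents, whence `2^k
-- v^(k+1)`.
theorem abs_trace_products_le (hA : ‖A‖ ≤ v) (hB : ‖B‖ ≤ v) (hD : ‖D‖ ≤ 2)
    (htr : ∀ M : Matrix (Fin n) (Fin n) ℂ, ‖(M * D).trace‖ ≤ 2 * ‖M‖) :
    |(A * D * B).trace.im| ≤ 2 * v ^ 2 ∧ |(A * D * B * D * B).trace.im| ≤ 4 * v ^ 3 ∧
      |(A * D * B * D * B * D * B).trace.im| ≤ 8 * v ^ 4 := by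
  have hv : 0 ≤ v := (norm_nonneg _).trans hA
  have htr' : ∀ (M : Matrix (Fin n) (Fin n) ℂ) (K : ℝ), ‖M‖ ≤ K → |(M * D).trace.im| ≤ 2 * K :=
    fun M K h => (Complex.abs_im_le_norm _).trans ((htr M).trans (by linarith))
  have hmul : ∀ (M N : Matrix (Fin n) (Fin n) ℂ) (K L : ℝ), 0 ≤ K → ‖M‖ ≤ K → ‖N‖ ≤ L →
      ‖M * N‖ ≤ K * L := fun M N K L hK hM hN =>
    (norm_mul_le _ _).trans (mul_le_mul hM hN (norm_nonneg _) hK)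
  have n1 : ‖B * A‖ ≤ v * v := hmul _ _ _ _ hv hB hA
  have n2 : ‖B * A * D * B‖ ≤ v * v * 2 * v :=
    hmul _ _ _ _ (by positivity) (hmul _ _ _ _ (by positivity) n1 hD) hB
  have n3 : ‖B * A * D * B * D * B‖ ≤ v * v * 2 * v * 2 * v :=
    hmul _ _ _ _ (by positivity) (hmul _ _ _ _ (by positivity) n2 hD) hB
  refine ⟨?_, ?_, ?_⟩
  · rw [Matrix.trace_mul_comm, ← mul_assoc]
    exact (htr' _ _ n1).trans_eq (by ring)
  · rw [Matrix.trace_mul_comm]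
    simpa only [← mul_assoc] using (htr' _ _ n2).trans_eq (by ring)
  · rw [Matrix.trace_mul_comm]
    simpa only [← mul_assoc] using (htr' _ _ n3).trans_eq (by ring)

theorem measurable_im_trace_products {R : (UpperIndex n → ℝ) → Matrix (Fin n) (Fin n) ℂ}
    (hR : Continuous R) (D : Matrix (Fin n) (Fin n) ℂ) :
    Measurable (fun w => (R w * D * R w).trace.im) ∧
      Measurable fun w => (R w * D * R w * D * R w).trace.im := by
  have h1 : Continuous fun w => R w * D * R w :=
    (hR.matrix_mul continuous_const).matrix_mul hR
  have h2 : Continuous fun w => R w * D * R w * D * R w :=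
    (h1.matrix_mul continuous_const).matrix_mul hR
  exact ⟨(Complex.continuous_im.comp h1.matrix_trace).measurable,
    (Complex.continuous_im.comp h2.matrix_trace).measurable⟩

end Expansion

theorem complexResolvent_symmetricMatrix_update {z : ℂ} (hz : z.im ≠ 0) (c : ℝ)
    (w : UpperIndex n → ℝ) (p : UpperIndex n) (hw : w p = 0) (t : ℝ) :
    complexResolvent (c • symmetricMatrix (Function.update w p t)) z
      = complexResolvent (c • symmetricMatrix w) z - ((c * t : ℝ) : ℂ) •
        (complexResolvent (c • symmetricMatrix (Function.update w p t)) z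
          * (symmetricMatrix (Pi.single p 1)).map Complex.ofReal
          * complexResolvent (c • symmetricMatrix w) z) := by
  have h := complexResolvent_sub ((isSymm_symmetricMatrix (Function.update w p t)).smul c)
    ((isSymm_symmetricMatrix w).smul c) hz
  have h2 : (c • symmetricMatrix (Function.update w p t)).map Complex.ofReal
      - (c • symmetricMatrix w).map Complex.ofReal
      = ((c * t : ℝ) : ℂ) • (symmetricMatrix (Pi.single p 1)).map Complex.ofReal := by
    rw [symmetricMatrix_update w p hw]
    ext i j
    simp
    ring
  rwa [h2, mul_smul_comm, smul_mul_assoc] at h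

/-- Second order expansion of the resolvent trace along a perturbation of one entry. -/
theorem exists_coordExpansion_imStieltjes {z : ℂ} (hz : 0 < z.im) (p : UpperIndex n) :
    ∃ a b : (UpperIndex n → ℝ) → ℝ,
      CoordExpansion (fun w => imStieltjes z (symmetricMatrix w)) a b p
      ((n : ℝ)⁻¹ * (Real.sqrt n)⁻¹ * (2 * z.im⁻¹ ^ 2))
      ((n : ℝ)⁻¹ * (Real.sqrt n)⁻¹ ^ 2 * (8 * z.im⁻¹ ^ 3))
      ((n : ℝ)⁻¹ * (Real.sqrt n)⁻¹ ^ 3 * (8 * z.im⁻¹ ^ 4)) := by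
  have hc0 : 0 ≤ (Real.sqrt n)⁻¹ := by positivity
  have hv0 : 0 ≤ z.im⁻¹ := by positivity
  have hc : Continuous fun w : UpperIndex n → ℝ => (Real.sqrt n)⁻¹ • symmetricMatrix w :=
    continuous_matrix fun i j => continuous_const.mul (continuous_symmetricMatrix.matrix_elem i j)
  have hm := measurable_im_trace_products (continuous_complexResolvent hc continuous_const
    (fun w : UpperIndex n → ℝ => (isSymm_symmetricMatrix w).smul _) fun _ => hz.ne')
    ((symmetricMatrix (Pi.single p 1)).map Complex.ofReal)
  have hbd : ∀ w w' : UpperIndex n → ℝ, _ := fun w w' => abs_trace_products_le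
    (norm_complexResolvent_le ((isSymm_symmetricMatrix w).smul (Real.sqrt n)⁻¹) hz)
    (norm_complexResolvent_le ((isSymm_symmetricMatrix w').smul (Real.sqrt n)⁻¹) hz)
    (norm_symmetricMatrix_single_le p) (norm_trace_mul_symmetricMatrix_single_le · p)
  have hst := complexResolvent_symmetricMatrix_update hz.ne' (Real.sqrt n)⁻¹ (p := p)
  have hf : ∀ w : UpperIndex n → ℝ, imStieltjes z (symmetricMatrix w) = (n : ℝ)⁻¹ *
    (complexResolvent ((Real.sqrt n)⁻¹ • symmetricMatrix w) z).trace.im := fun _ => rfl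
  generalize (symmetricMatrix (Pi.single p 1)).map Complex.ofReal = D at hm hbd hst
  clear hc
  generalize (Real.sqrt n)⁻¹ = c at *
  generalize hR : (fun w : UpperIndex n → ℝ => complexResolvent (c • symmetricMatrix w) z) = R
  have hRw : ∀ w : UpperIndex n → ℝ, complexResolvent (c • symmetricMatrix w) z = R w :=
    fun w => by rw [← hR]
  simp only [hRw] at hm hbd hst hf
  generalize z.im⁻¹ = v at *
  refine ⟨fun w => -((n : ℝ)⁻¹ * c * (R w * D * R w).trace.im),
    fun w => (n : ℝ)⁻¹ * c ^ 2 * (R w * D * R w * D * R w).trace.im,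
    (hm.1.const_mul _).neg, hm.2.const_mul _, ?_, ?_, ?_, ?_⟩
  · intro w
    rw [abs_neg, abs_mul, abs_of_nonneg (by positivity)]
    exact mul_le_mul_of_nonneg_left (hbd w w).1 (by positivity)
  · intro w
    rw [abs_mul, abs_of_nonneg (by positivity)]
    -- The sharper constant `4 v³` is doubled because the same `C₂` must bound the quadratic
    -- remainder, a difference of two such traces.
    exact mul_le_mul_of_nonneg_left ((hbd w w).2.1.trans
      (mul_le_mul_of_nonneg_right (by norm_num) (by positivity))) (by positivity)
  · intro w hw t
    have h := congrArg (fun M : Matrix (Fin n) (Fin n) ℂ => M.trace.im)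
      (resolvent_expansion_two (hst w hw t))
    simp only [Matrix.trace_add, Matrix.trace_sub, Matrix.trace_smul, smul_eq_mul, Complex.add_im,
      Complex.sub_im, ← Complex.ofReal_pow, Complex.im_ofReal_mul] at h
    have h1 := (hbd (Function.update w p t) w).2.1
    have h2 := (hbd w w).2.1
    simp only [hf]
    rw [h]
    generalize (R (Function.update w p t) * D * R w * D * R w).trace.im = r₁ at *
    generalize (R w * D * R w * D * R w).trace.im = r₂ at *
    calc _ = |((n : ℝ)⁻¹ * c ^ 2 * t ^ 2) * (r₁ - r₂)| := by congr 1; ring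
      _ ≤ ((n : ℝ)⁻¹ * c ^ 2 * t ^ 2) * (4 * v ^ 3 + 4 * v ^ 3) := by
          rw [abs_mul, abs_of_nonneg (a := (n : ℝ)⁻¹ * c ^ 2 * t ^ 2) (by positivity)]
          exact mul_le_mul_of_nonneg_left ((abs_sub _ _).trans (add_le_add h1 h2)) (by positivity)
      _ = _ := by ring
  · intro w hw t
    have h := congrArg (fun M : Matrix (Fin n) (Fin n) ℂ => M.trace.im)
      (resolvent_expansion_three (hst w hw t))
    simp only [Matrix.trace_add, Matrix.trace_sub, Matrix.trace_smul, smul_eq_mul, Complex.add_im,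
      Complex.sub_im, ← Complex.ofReal_pow, Complex.im_ofReal_mul] at h
    have h1 := (hbd (Function.update w p t) w).2.2
    simp only [hf]
    rw [h]
    generalize (R (Function.update w p t) * D * R w * D * R w * D * R w).trace.im = r₁ at *
    calc _ = |-(((n : ℝ)⁻¹ * c ^ 3) * t ^ 3 * r₁)| := by congr 1; ring
      _ ≤ ((n : ℝ)⁻¹ * c ^ 3) * |t| ^ 3 * (8 * v ^ 4) := by
          rw [abs_neg, abs_mul, abs_mul, abs_pow,
            abs_of_nonneg (a := (n : ℝ)⁻¹ * c ^ 3) (by positivity)]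
          exact mul_le_mul_of_nonneg_left h1 (by positivity)
      _ = _ := by ring

end ImStieltjes

/-! ### Replacement for random matrices -/

section SwapMatrices

/-- The vector of entries on and above the diagonal of a random matrix. -/
def upperEntries {Ω : Type*} {n : ℕ} (X : Ω → Matrix (Fin n) (Fin n) ℝ) (ω : Ω) :
    UpperIndex n → ℝ :=
  fun p => X ω p.1.1 p.1.2

theorem symmetricMatrix_upperEntries {Ω : Type*} {n : ℕ} {X : Ω → Matrix (Fin n) (Fin n) ℝ}
    (hX : ∀ ω, (X ω).IsSymm) (ω : Ω) :
    symmetricMatrix (upperEntries X ω) = X ω :=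
  symmetricMatrix_eq_of_isSymm (hX ω)

variable {Ω : Type*} [MeasurableSpace Ω] {P : Measure Ω} {n : ℕ}
  {X Y : Ω → Matrix (Fin n) (Fin n) ℝ} {σ : Fin n → Fin n → ℝ}

theorem IsCenteredSymmetric.measurable_upperEntries (hX : IsCenteredSymmetric P X σ) :
    Measurable (upperEntries X) :=
  measurable_pi_lambda _ fun p => hX.measurable p.1.1 p.1.2

theorem IsCenteredSymmetric.sigmaOthers_le (hX : IsCenteredSymmetric P X σ) (i j : Fin n) :
    sigmaOthers X i j ≤ ‹MeasurableSpace Ω› :=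
  iSup_le fun _ => (hX.measurable _ _).comap_le

theorem IsCenteredSymmetric.swapVector (hX : IsCenteredSymmetric P X σ)
    (hm : MartingaleCondition P X) :
    SwapVector P (upperEntries X) (fun p => sigmaOthers X p.1.1 p.1.2) where
  measurable := hX.measurable_upperEntries
  memLp p := hX.memLp_two p.1.1 p.1.2
  le p := hX.sigmaOthers_le _ _
  measurable_other p q hqp := by
    refine Measurable.of_comap_le (le_iSup_of_le
      (⟨q.1, q.2, ?_⟩ : {r : Fin n × Fin n // r.1 ≤ r.2 ∧ r ≠ (min p.1.1 p.1.2, max p.1.1 p.1.2)})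
      le_rfl)
    rw [min_eq_left p.2, max_eq_right p.2]
    exact fun h => hqp (Subtype.ext h)
  condExp_eq_zero p := hm _ _ p.2

/-- Independence makes the conditional expectation constant. Taking `g` to be the identity and the
square shows that Y is conditionally centered with zero variance defect. -/
theorem HasIndepGaussianEntries.condExp_comp_eq [IsProbabilityMeasure P]
    (hY : IsCenteredSymmetric P Y σ) (hG : HasIndepGaussianEntries P Y) {i j : Fin n} (hij : i ≤ j)
    {g : ℝ → ℝ} (hg : Measurable g) :
    P[fun ω => g (Y ω i j) | sigmaOthers Y i j] =ᵐ[P] fun _ => ∫ ω, g (Y ω i j) ∂P := by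
  let m : UpperIndex n → MeasurableSpace Ω :=
    fun p => MeasurableSpace.comap (fun ω => Y ω p.1.1 p.1.2) inferInstance
  have hm : ∀ p, m p ≤ ‹MeasurableSpace Ω› := fun p => (hY.measurable _ _).comap_le
  let p : UpperIndex n := ⟨(i, j), hij⟩
  have hind : Indep (⨆ q ∈ ({p} : Set (UpperIndex n)), m q)
      (⨆ q ∈ ({p}ᶜ : Set (UpperIndex n)), m q) P :=
    indep_iSup_of_disjoint hm hG.indep.iIndep disjoint_compl_right
  have hle : sigmaOthers Y i j ≤ ⨆ q ∈ ({p}ᶜ : Set (UpperIndex n)), m q := by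
    refine iSup_le fun q => ?_
    refine le_iSup₂_of_le (⟨q.1, q.2.1⟩ : UpperIndex n) ?_ le_rfl
    intro h
    apply q.2.2
    have h' : (min i j, max i j) = (i, j) := by rw [min_eq_left hij, max_eq_right hij]
    exact (congrArg Subtype.val (Set.mem_singleton_iff.1 h)).trans h'.symm
  have hind' : Indep (m p) (sigmaOthers Y i j) P := by
    rw [iSup_singleton] at hind
    exact indep_of_indep_of_le_right hind hle
  refine condExp_indep_eq (hm p) (hY.sigmaOthers_le i j) ?_ hind'
  exact (hg.comp (comap_measurable (fun ω => Y ω i j))).stronglyMeasurable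

theorem HasIndepGaussianEntries.martingaleCondition [IsProbabilityMeasure P]
    (hY : IsCenteredSymmetric P Y σ) (hG : HasIndepGaussianEntries P Y) :
    MartingaleCondition P Y := by
  intro i j hij
  have h := hG.condExp_comp_eq hY hij measurable_id
  simp only [id, hY.mean i j] at h
  exact h

theorem HasIndepGaussianEntries.integral_condVar_defect [IsProbabilityMeasure P]
    (hY : IsCenteredSymmetric P Y σ) (hG : HasIndepGaussianEntries P Y) {i j : Fin n}
    (hij : i ≤ j) :
    ∫ ω, |(P[fun ω' => Y ω' i j ^ 2 | sigmaOthers Y i j]) ω - σ i j ^ 2| ∂P = 0 := by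
  have h := hG.condExp_comp_eq hY hij (g := fun t => t ^ 2) (by fun_prop)
  simp only [hY.second_moment i j] at h
  refine integral_eq_zero_of_ae ?_
  filter_upwards [h] with ω hω
  simp [hω]

theorem sum_upperIndex_le {F : Fin n → Fin n → ℝ} (hF : ∀ i j, 0 ≤ F i j) :
    ∑ p : UpperIndex n, F p.1.1 p.1.2 ≤ ∑ i, ∑ j, F i j := by
  rw [← Fintype.sum_prod_type' (f := F)]
  have h := Finset.sum_subtype_eq_sum_filter (s := (Finset.univ : Finset (Fin n × Fin n)))
    (p := fun p => p.1 ≤ p.2) (fun p => F p.1 p.2)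
  rw [Finset.subtype_univ] at h
  rw [h]
  exact Finset.sum_le_sum_of_subset_of_nonneg (Finset.filter_subset _ _) fun p _ _ => hF _ _

/-- The average variance of the entries. -/
def meanVariance (σ : Fin n → Fin n → ℝ) : ℝ := 1 / (n : ℝ) ^ 2 * ∑ i, ∑ j, σ i j ^ 2

/-- At threshold `τ √n` both `C₂` and `C₃ T` are multiples of `n⁻²`, so the sum over entries becomes
an average. The bound `d` is left free: it is `condVarianceDefect` for X and `0` for Y. -/
theorem IsCenteredSymmetric.sum_swapError_le (hX : IsCenteredSymmetric P X σ) (hn : 0 < n)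
    {v τ : ℝ} (hv : 0 ≤ v) (hτ : 0 ≤ τ) {d : ℝ}
    (hd : 1 / (n : ℝ) ^ 2 * ∑ p : UpperIndex n, ∫ ω,
      |(P[fun ω => upperEntries X ω p ^ 2 | sigmaOthers X p.1.1 p.1.2]) ω
        - σ p.1.1 p.1.2 ^ 2| ∂P ≤ d) :
    ∑ p : UpperIndex n, swapError (sigmaOthers X p.1.1 p.1.2) P (fun ω => upperEntries X ω p)
      (σ p.1.1 p.1.2 ^ 2) (τ * Real.sqrt n) ((n : ℝ)⁻¹ * (Real.sqrt n)⁻¹ ^ 2 * (8 * v ^ 3))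
      ((n : ℝ)⁻¹ * (Real.sqrt n)⁻¹ ^ 3 * (8 * v ^ 4))
    ≤ 8 * v ^ 3 * (d + lindebergRatio P X τ) + 8 * v ^ 4 * τ * meanVariance σ := by
  have hn' : (0 : ℝ) < n := by exact_mod_cast hn
  have hs : (0 : ℝ) < Real.sqrt n := Real.sqrt_pos.2 hn'
  have hsq : Real.sqrt n ^ 2 = n := Real.sq_sqrt hn'.le
  have e2 : (n : ℝ)⁻¹ * (Real.sqrt n)⁻¹ ^ 2 * (8 * v ^ 3) = 8 * v ^ 3 * (1 / (n : ℝ) ^ 2) := by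
    rw [inv_pow, hsq]; field_simp
  have e3 : (n : ℝ)⁻¹ * (Real.sqrt n)⁻¹ ^ 3 * (8 * v ^ 4) * (τ * Real.sqrt n)
      = 8 * v ^ 4 * τ * (1 / (n : ℝ) ^ 2) := by
    have : (Real.sqrt n)⁻¹ ^ 3 * Real.sqrt n = (n : ℝ)⁻¹ := by
      rw [show (n : ℝ)⁻¹ = (Real.sqrt n ^ 2)⁻¹ by rw [hsq]]
      field_simp
    calc _ = (n : ℝ)⁻¹ * ((Real.sqrt n)⁻¹ ^ 3 * Real.sqrt n) * (8 * v ^ 4 * τ) := by ring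
      _ = _ := by rw [this]; field_simp
  have h1 : ∑ p : UpperIndex n, ∫ ω in {ω | τ * Real.sqrt n ≤ |X ω p.1.1 p.1.2|},
      |X ω p.1.1 p.1.2| ^ 2 ∂P ≤ _ :=
    sum_upperIndex_le (F := fun i j => ∫ ω in {ω | τ * Real.sqrt n ≤ |X ω i j|},
      |X ω i j| ^ 2 ∂P) fun i j => integral_nonneg fun ω => by positivity
  have h2 : ∑ p : UpperIndex n, σ p.1.1 p.1.2 ^ 2 ≤ ∑ i, ∑ j, σ i j ^ 2 :=
    sum_upperIndex_le (F := fun i j => σ i j ^ 2) fun i j => sq_nonneg _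
  simp only [swapError, e2, e3]
  simp only [upperEntries, hX.second_moment] at hd ⊢
  rw [Finset.sum_add_distrib, ← Finset.mul_sum, ← Finset.mul_sum, Finset.sum_add_distrib,
    lindebergRatio, meanVariance, mul_assoc (8 * v ^ 3), mul_assoc (8 * v ^ 4 * τ), mul_add]
  refine add_le_add (mul_le_mul_of_nonneg_left (add_le_add hd ?_) (by positivity)) ?_
  · exact mul_le_mul_of_nonneg_left h1 (by positivity)
  · exact mul_le_mul_of_nonneg_left (mul_le_mul_of_nonneg_left h2 (by positivity)) (by positivity)

/-- Universality of the expected Stieltjes transform, with an explicit error bound. -/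
theorem abs_integral_imStieltjes_sub_le [IsProbabilityMeasure P]
    (hX : IsCenteredSymmetric P X σ) (hY : IsCenteredSymmetric P Y σ)
    (hXY : IndepFun (fun ω (p : Fin n × Fin n) => X ω p.1 p.2)
      (fun ω (p : Fin n × Fin n) => Y ω p.1 p.2) P)
    (hm : MartingaleCondition P X) (hG : HasIndepGaussianEntries P Y) (hn : 0 < n)
    {z : ℂ} (hz : 0 < z.im) {τ : ℝ} (hτ : 0 ≤ τ) :
    |∫ ω, imStieltjes z (X ω) ∂P - ∫ ω, imStieltjes z (Y ω) ∂P| ≤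
      8 * z.im⁻¹ ^ 3 * (condVarianceDefect P X σ + lindebergRatio P X τ + lindebergRatio P Y τ)
        + 16 * z.im⁻¹ ^ 4 * τ * meanVariance σ := by
  choose a b hab using fun p : UpperIndex n => exists_coordExpansion_imStieltjes hz p
  have hind : IndepFun (upperEntries X) (upperEntries Y) P := by
    have hr : Measurable fun (r : Fin n × Fin n → ℝ) (p : UpperIndex n) => r p.1 :=
      measurable_pi_lambda _ fun p => measurable_pi_apply _
    exact hXY.comp hr hr
  have hf : Measurable fun w : UpperIndex n → ℝ => imStieltjes z (symmetricMatrix w) :=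
    (continuous_imStieltjes continuous_symmetricMatrix continuous_const isSymm_symmetricMatrix
      fun _ => hz.ne').measurable
  have key := abs_integral_sub_le_sum_swapError (hX.swapVector hm)
    (hY.swapVector (hG.martingaleCondition hY)) hind hf
    (fun w => abs_imStieltjes_le hz (isSymm_symmetricMatrix w)) hab (by positivity)
    (fun p => σ p.1.1 p.1.2 ^ 2) (T := τ * Real.sqrt n) (by positivity)
  simp only [symmetricMatrix_upperEntries hX.symm, symmetricMatrix_upperEntries hY.symm,
    Finset.sum_add_distrib] at key
  have hv : 0 ≤ z.im⁻¹ := by positivity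
  have kX := hX.sum_swapError_le hn hv hτ (d := condVarianceDefect P X σ) (by
    refine mul_le_mul_of_nonneg_left ?_ (by positivity)
    exact sum_upperIndex_le (F := fun i j => ∫ ω,
      |(P[fun ω' => (X ω' i j) ^ 2 | sigmaOthers X i j]) ω - (σ i j) ^ 2| ∂P)
      fun i j => integral_nonneg fun ω => abs_nonneg _)
  have kY := hY.sum_swapError_le hn hv hτ (d := 0) (by
    refine le_of_eq (mul_eq_zero_of_right _ (Finset.sum_eq_zero fun p _ => ?_))
    exact hG.integral_condVar_defect hY p.2)
  linarith

theorem meanVariance_eq (σ : Fin n → Fin n → ℝ) :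
    meanVariance σ = 1 / (n : ℝ) * ∑ i, rowVariance σ i := by
  simp only [meanVariance, rowVariance, ← Finset.mul_sum]
  ring

theorem meanVariance_le (hn : 0 < n) (σ : Fin n → Fin n → ℝ) :
    meanVariance σ ≤ 1 + 1 / (n : ℝ) * ∑ i, |rowVariance σ i - 1| := by
  have hn' : (0 : ℝ) < n := by exact_mod_cast hn
  have h : ∑ i, rowVariance σ i ≤ ∑ i : Fin n, (1 + |rowVariance σ i - 1|) :=
    Finset.sum_le_sum fun i _ => by linarith [le_abs_self (rowVariance σ i - 1)]
  rw [meanVariance_eq]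
  calc _ ≤ 1 / (n : ℝ) * ∑ i : Fin n, (1 + |rowVariance σ i - 1|) :=
        mul_le_mul_of_nonneg_left h (by positivity)
    _ = _ := by
      rw [Finset.sum_add_distrib, mul_add]
      simp [hn'.ne']

theorem meanVariance_nonneg (σ : Fin n → Fin n → ℝ) : 0 ≤ meanVariance σ := by
  unfold meanVariance
  positivity

end SwapMatrices

/-! ### Spectral statistics and Cauchy smoothing -/

section Spectral

variable {n : ℕ}

/-- Both sides are the trace of the square of `A`. -/
theorem sum_sq_roots_charpoly {A : Matrix (Fin n) (Fin n) ℝ} (hA : A.IsSymm) :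
    (A.charpoly.roots.map fun t => t ^ 2).sum = ∑ i, ∑ j, A i j ^ 2 := by
  obtain ⟨U, μ, h, hr⟩ := exists_unitary_diagonalization hA
  have h1 : (A.map Complex.ofReal * A.map Complex.ofReal).trace = ∑ i, ((μ i : ℂ)) ^ 2 := by
    rw [h]
    have : U.1 * Matrix.diagonal (fun i => (μ i : ℂ)) * star U.1
        * (U.1 * Matrix.diagonal (fun i => (μ i : ℂ)) * star U.1)
        = U.1 * (Matrix.diagonal (fun i => (μ i : ℂ)) * (star U.1 * U.1)
          * Matrix.diagonal (fun i => (μ i : ℂ))) * star U.1 := by simp only [mul_assoc]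
    rw [this, Unitary.coe_star_mul_self, mul_one, Matrix.trace_mul_comm, ← mul_assoc,
      Unitary.coe_star_mul_self, one_mul, Matrix.diagonal_mul_diagonal, Matrix.trace_diagonal]
    simp only [sq]
  have h2 : (A.map Complex.ofReal * A.map Complex.ofReal).trace
      = ((∑ i, ∑ j, A i j ^ 2 : ℝ) : ℂ) := by
    simp only [Matrix.trace, Matrix.diag_apply, Matrix.mul_apply, Matrix.map_apply]
    push_cast
    refine Finset.sum_congr rfl fun i _ => Finset.sum_congr rfl fun j _ => ?_
    rw [hA.apply i j, sq]
  rw [hr, Multiset.map_map]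
  have h3 := h1.symm.trans h2
  exact_mod_cast h3

/-- Simultaneous description of the spectral statistics through the eigenvalues `μ`. -/
theorem exists_eigenvalues {A : Matrix (Fin n) (Fin n) ℝ} (hA : A.IsSymm) :
    ∃ μ : Fin n → ℝ,
      (∀ x, empiricalSpectralCDF A x = (n : ℝ)⁻¹ * ∑ i, if μ i ≤ x then 1 else 0) ∧
      (∀ z : ℂ, z.im ≠ 0 → imStieltjes z A = (n : ℝ)⁻¹ * ∑ i, ((μ i - z)⁻¹ : ℂ).im) ∧
      (n : ℝ)⁻¹ * ∑ i, μ i ^ 2 = 1 / (n : ℝ) ^ 2 * ∑ i, ∑ j, A i j ^ 2 := by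
  have hs : ((Real.sqrt n)⁻¹ • A).IsSymm := hA.smul _
  obtain ⟨U, μ, -, hr⟩ := exists_unitary_diagonalization hs
  refine ⟨μ, fun x => ?_, fun z hz => ?_, ?_⟩
  · rw [empiricalSpectralCDF, hr, Multiset.countP_map, div_eq_inv_mul, Finset.sum_boole]
    rfl
  · rw [imStieltjes, trace_complexResolvent hs hz, hr, Multiset.map_map]
    congr 1
    exact Complex.im_sum Finset.univ fun i => ((μ i - z)⁻¹ : ℂ)
  · have h := sum_sq_roots_charpoly hs
    rw [hr, Multiset.map_map] at h
    have h' : ∑ i, μ i ^ 2 = ∑ i, ∑ j, ((Real.sqrt n)⁻¹ • A) i j ^ 2 := h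
    rw [h']
    simp only [Matrix.smul_apply, smul_eq_mul, mul_pow, inv_pow, Real.sq_sqrt (Nat.cast_nonneg n),
      ← Finset.mul_sum]
    ring

/-- The integrand is `v / ((u - t)² + v²)`, the derivative of `arctan ((u - t) / v)`. -/
theorem integral_im_inv_sub {v : ℝ} (hv : 0 < v) (a b t : ℝ) :
    ∫ u in a..b, (((t : ℂ) - (u + v * Complex.I))⁻¹).im
      = Real.arctan ((b - t) / v) - Real.arctan ((a - t) / v) := by
  have hd : ∀ u : ℝ, HasDerivAt (fun u => Real.arctan ((u - t) / v))
      (((t : ℂ) - (u + v * Complex.I))⁻¹).im u := by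
    intro u
    have h := (((hasDerivAt_id u).sub_const t).div_const v).arctan
    refine h.congr_deriv ?_
    rw [Complex.inv_im, Complex.normSq_apply]
    simp
    have h0 : (t - u) * (t - u) + v * v ≠ 0 := by
      nlinarith [mul_self_nonneg (t - u), mul_pos hv hv]
    have h1 : v ^ 2 + (u - t) ^ 2 ≠ 0 := by
      nlinarith [sq_nonneg (u - t), sq_pos_of_pos hv]
    field_simp
    ring
  refine intervalIntegral.integral_eq_sub_of_hasDerivAt (fun u _ => hd u) ?_
  refine Continuous.intervalIntegrable ?_ _ _
  refine Complex.continuous_im.comp (Continuous.inv₀ (by fun_prop) fun u => ?_)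
  exact ofReal_sub_ne_zero (by simpa using hv.ne') t

/-- The Cauchy smoothed spectral mass of an interval. -/
def cauchyMass (a b v : ℝ) (A : Matrix (Fin n) (Fin n) ℝ) : ℝ :=
  Real.pi⁻¹ * ∫ u in a..b, imStieltjes (u + v * Complex.I) A

/-- The Cauchy kernel of width `v` convolved with the indicator function of `[a, b]`. -/
def cauchyKernel (a b v t : ℝ) : ℝ :=
  Real.pi⁻¹ * (Real.arctan ((b - t) / v) - Real.arctan ((a - t) / v))

theorem cauchyMass_eq {v : ℝ} (hv : 0 < v) (a b : ℝ) {A : Matrix (Fin n) (Fin n) ℝ}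
    {μ : Fin n → ℝ}
    (h : ∀ z : ℂ, z.im ≠ 0 → imStieltjes z A = (n : ℝ)⁻¹ * ∑ i, ((μ i - z)⁻¹ : ℂ).im) :
    cauchyMass a b v A = (n : ℝ)⁻¹ * ∑ i, cauchyKernel a b v (μ i) := by
  have h1 : ∀ u : ℝ, imStieltjes (u + v * Complex.I) A
      = (n : ℝ)⁻¹ * ∑ i, ((μ i - (u + v * Complex.I))⁻¹ : ℂ).im :=
    fun u => h _ (by simpa using hv.ne')
  have hc : ∀ t : ℝ, Continuous fun u : ℝ => (((t : ℂ) - (u + v * Complex.I))⁻¹).im := fun t =>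
    Complex.continuous_im.comp (Continuous.inv₀ (by fun_prop) fun u =>
      ofReal_sub_ne_zero (by simpa using hv.ne') t)
  simp only [cauchyMass, cauchyKernel, h1, intervalIntegral.integral_const_mul]
  rw [intervalIntegral.integral_finsetSum fun i _ => (hc (μ i)).intervalIntegrable _ _]
  simp only [integral_im_inv_sub hv, Finset.mul_sum]
  exact Finset.sum_congr rfl fun i _ => by ring

theorem continuous_imStieltjes_line {v : ℝ} (hv : 0 < v) :
    Continuous fun p : (UpperIndex n → ℝ) × ℝ =>
      imStieltjes (p.2 + v * Complex.I) (symmetricMatrix p.1) :=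
  continuous_imStieltjes (continuous_symmetricMatrix.comp continuous_fst) (by fun_prop)
    (fun p => isSymm_symmetricMatrix p.1) (fun p => by simpa using hv.ne')

theorem continuous_cauchyMass {v : ℝ} (hv : 0 < v) (a b : ℝ) :
    Continuous fun w : UpperIndex n → ℝ => cauchyMass a b v (symmetricMatrix w) :=
  continuous_const.mul (intervalIntegral.continuous_parametric_intervalIntegral_of_continuous'
    (continuous_imStieltjes_line hv) a b)

theorem cauchyKernel_le_one (a b : ℝ) {v : ℝ} (t : ℝ) : cauchyKernel a b v t ≤ 1 := by
  have h1 := (Real.arctan_lt_pi_div_two ((b - t) / v)).le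
  have h2 := (Real.neg_pi_div_two_lt_arctan ((a - t) / v)).le
  rw [cauchyKernel, inv_mul_le_iff₀ Real.pi_pos]
  linarith

theorem cauchyKernel_nonneg {a b v : ℝ} (hab : a ≤ b) (hv : 0 < v) (t : ℝ) :
    0 ≤ cauchyKernel a b v t := by
  have h : Real.arctan ((a - t) / v) ≤ Real.arctan ((b - t) / v) :=
    Real.arctan_mono (by gcongr)
  exact mul_nonneg (by positivity) (by linarith)

/-- The mass that the Cauchy distribution of width `v` puts outside `[-ε, ε]`. -/
def cauchyTail (ε v : ℝ) : ℝ := 1 - 2 * (Real.pi⁻¹ * Real.arctan (ε / v))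

theorem cauchyTail_nonneg (ε v : ℝ) : 0 ≤ cauchyTail ε v := by
  have h : Real.pi⁻¹ * Real.arctan (ε / v) ≤ 1 / 2 := by
    rw [inv_mul_le_iff₀ Real.pi_pos]
    linarith [Real.arctan_lt_pi_div_two (ε / v)]
  unfold cauchyTail
  linarith

theorem tendsto_cauchyTail {ε : ℝ} (hε : 0 < ε) :
    Tendsto (fun v => cauchyTail ε v) (𝓝[>] 0) (𝓝 0) := by
  have h1 : Tendsto (fun v => ε / v) (𝓝[>] (0 : ℝ)) atTop := by
    simpa only [div_eq_mul_inv] using tendsto_inv_nhdsGT_zero.const_mul_atTop hε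
  have h2 := (tendsto_nhds_of_tendsto_nhdsWithin Real.tendsto_arctan_atTop).comp h1
  have h3 := ((h2.const_mul Real.pi⁻¹).const_mul 2).const_sub 1
  have : 1 - 2 * (Real.pi⁻¹ * (Real.pi / 2)) = 0 := by
    field_simp
    ring
  rw [this] at h3
  exact h3

theorem one_sub_cauchyTail_le {a b v ε t : ℝ} (hv : 0 < v) (h1 : t + ε ≤ b) (h2 : a ≤ t - ε) :
    1 - cauchyTail ε v ≤ cauchyKernel a b v t := by
  have h3 : Real.arctan (ε / v) ≤ Real.arctan ((b - t) / v) :=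
    Real.arctan_mono (by gcongr; linarith)
  have h4 : Real.arctan ((a - t) / v) ≤ -Real.arctan (ε / v) := by
    rw [← Real.arctan_neg, ← neg_div]
    exact Real.arctan_mono (by gcongr; linarith)
  have h5 : Real.pi⁻¹ * (2 * Real.arctan (ε / v))
      ≤ Real.pi⁻¹ * (Real.arctan ((b - t) / v) - Real.arctan ((a - t) / v)) :=
    mul_le_mul_of_nonneg_left (by linarith) (by positivity)
  unfold cauchyTail cauchyKernel
  linarith

/-- Only one of the two tails is involved, so half of `cauchyTail` would suffice; the left endpoint
plays no role. -/
theorem cauchyKernel_le_cauchyTail {a b v ε t : ℝ} (hv : 0 < v) (h1 : b ≤ t - ε) :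
    cauchyKernel a b v t ≤ cauchyTail ε v := by
  have h3 : Real.arctan ((b - t) / v) ≤ -Real.arctan (ε / v) := by
    rw [← Real.arctan_neg, ← neg_div]
    exact Real.arctan_mono (by gcongr; linarith)
  have h4 := (Real.neg_pi_div_two_lt_arctan ((a - t) / v)).le
  have h5 : cauchyKernel a b v t ≤ Real.pi⁻¹ * (-Real.arctan (ε / v) + Real.pi / 2) :=
    mul_le_mul_of_nonneg_left (by linarith) (by positivity)
  have h6 : Real.pi⁻¹ * (-Real.arctan (ε / v) + Real.pi / 2)
      = 1 / 2 - Real.pi⁻¹ * Real.arctan (ε / v) := by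
    field_simp
    ring
  have h7 := cauchyTail_nonneg ε v
  unfold cauchyTail at h7 ⊢
  linarith

/-- With `h = 1 / (m + 1)`, the right endpoint exceeds `x` by `h` while the width is `h²`. The ratio
`h / h²` diverges, so a point at `t = x` still receives full mass and the limit is the indicator of
the closed half-line. This yields measurability of the empirical distribution function. -/
theorem tendsto_cauchyKernel_indicator (x t : ℝ) :
    Tendsto (fun m : ℕ => cauchyKernel (-(m : ℝ)) (x + 1 / (m + 1)) ((1 / ((m : ℝ) + 1)) ^ 2) t)
      atTop (𝓝 (if t ≤ x then 1 else 0)) := by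
  have h0 : Tendsto (fun m : ℕ => 1 / ((m : ℝ) + 1)) atTop (𝓝 0) :=
    tendsto_one_div_add_atTop_nhds_zero_nat
  have hpos : ∀ m : ℕ, 0 < 1 / ((m : ℝ) + 1) := fun m => by positivity
  have htail : ∀ δ : ℝ, 0 < δ →
      Tendsto (fun m : ℕ => cauchyTail δ (1 / ((m : ℝ) + 1))) atTop (𝓝 0) := fun δ hδ =>
    (tendsto_cauchyTail hδ).comp (tendsto_nhdsWithin_iff.2 ⟨h0, .of_forall hpos⟩)
  split_ifs with h
  · have hl := (htail 1 one_pos).const_sub 1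
    rw [sub_zero] at hl
    refine tendsto_of_tendsto_of_tendsto_of_le_of_le' hl tendsto_const_nhds ?_
      (.of_forall fun m => cauchyKernel_le_one _ _ _)
    filter_upwards [eventually_ge_atTop ⌈1 - t⌉₊] with m hm
    have hm' : 1 - t ≤ m := (Nat.le_ceil _).trans (by exact_mod_cast hm)
    have e : cauchyTail 1 (1 / ((m : ℝ) + 1))
        = cauchyTail (1 / ((m : ℝ) + 1)) ((1 / ((m : ℝ) + 1)) ^ 2) := by
      unfold cauchyTail
      congr 4
      have := (hpos m).ne'
      field_simp
    rw [e]
    refine one_sub_cauchyTail_le (by positivity) (by linarith) ?_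
    have : 1 / ((m : ℝ) + 1) ≤ 1 := by
      rw [div_le_one (by positivity)]
      linarith [(Nat.cast_nonneg m : (0 : ℝ) ≤ m)]
    linarith
  · push Not at h
    have hδ : 0 < (t - x) / 2 := by linarith
    refine tendsto_of_tendsto_of_tendsto_of_le_of_le' tendsto_const_nhds (htail _ hδ) ?_ ?_
    · filter_upwards [eventually_ge_atTop ⌈-x⌉₊] with m hm
      have hm' : -x ≤ m := (Nat.le_ceil _).trans (by exact_mod_cast hm)
      exact cauchyKernel_nonneg (by linarith [hpos m]) (by positivity) _
    · filter_upwards [h0.eventually_lt_const hδ] with m hm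
      -- Once `h < (t - x) / 2`, the point `t` lies at least `(t - x) / 2` beyond the right
      -- endpoint; replacing the width `h²` by the larger `h` only increases the tail.
      refine (cauchyKernel_le_cauchyTail (ε := (t - x) / 2) (by positivity) (by linarith)).trans ?_
      have h1 : 1 / ((m : ℝ) + 1) ≤ 1 := by
        rw [div_le_one (by positivity)]
        linarith [(Nat.cast_nonneg m : (0 : ℝ) ≤ m)]
      have h2 : (1 / ((m : ℝ) + 1)) ^ 2 ≤ 1 / ((m : ℝ) + 1) := by
        rw [sq]
        exact mul_le_of_le_one_left (hpos m).le h1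
      have h3 : Real.arctan ((t - x) / 2 / (1 / ((m : ℝ) + 1)))
          ≤ Real.arctan ((t - x) / 2 / (1 / ((m : ℝ) + 1)) ^ 2) :=
        Real.arctan_mono (div_le_div_of_nonneg_left hδ.le (by positivity) h2)
      have h4 := mul_le_mul_of_nonneg_left h3 (by positivity : 0 ≤ Real.pi⁻¹)
      unfold cauchyTail
      linarith

theorem measurable_empiricalSpectralCDF (x : ℝ) :
    Measurable fun w : UpperIndex n → ℝ => empiricalSpectralCDF (symmetricMatrix w) x := by
  refine measurable_of_tendsto_metrizable (f := fun (m : ℕ) w =>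
    cauchyMass (-(m : ℝ)) (x + 1 / (m + 1)) ((1 / ((m : ℝ) + 1)) ^ 2) (symmetricMatrix w))
    (fun m => (continuous_cauchyMass (by positivity) _ _).measurable) ?_
  refine tendsto_pi_nhds.2 fun w => ?_
  obtain ⟨μ, h1, h2, -⟩ := exists_eigenvalues (isSymm_symmetricMatrix w)
  rw [h1]
  have : ∀ m : ℕ, cauchyMass (-(m : ℝ)) (x + 1 / (m + 1)) ((1 / ((m : ℝ) + 1)) ^ 2)
      (symmetricMatrix w) = (n : ℝ)⁻¹ * ∑ i, cauchyKernel (-(m : ℝ)) (x + 1 / (m + 1))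
        ((1 / ((m : ℝ) + 1)) ^ 2) (μ i) := fun m => cauchyMass_eq (by positivity) _ _ h2
  simp only [this]
  exact (tendsto_finsetSum _ fun i _ => tendsto_cauchyKernel_indicator x (μ i)).const_mul _

/-- The normalized squared Frobenius norm, that is, the second moment of the spectrum. -/
def meanSquare (A : Matrix (Fin n) (Fin n) ℝ) : ℝ := 1 / (n : ℝ) ^ 2 * ∑ i, ∑ j, A i j ^ 2

variable {A : Matrix (Fin n) (Fin n) ℝ}

theorem inv_mul_sum_le_of_forall_le {f g : Fin n → ℝ} (h : ∀ i, f i ≤ g i) :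
    (n : ℝ)⁻¹ * ∑ i, f i ≤ (n : ℝ)⁻¹ * ∑ i, g i :=
  mul_le_mul_of_nonneg_left (Finset.sum_le_sum fun i _ => h i) (by positivity)

theorem inv_mul_sum_add_const_le (f : Fin n → ℝ) {c : ℝ} (hc : 0 ≤ c) :
    (n : ℝ)⁻¹ * ∑ i, (f i + c) ≤ (n : ℝ)⁻¹ * ∑ i, f i + c := by
  rw [Finset.sum_add_distrib, mul_add]
  have : (n : ℝ)⁻¹ * n * c ≤ 1 * c := mul_le_mul_of_nonneg_right inv_mul_le_one hc
  simp only [Finset.sum_const, Finset.card_univ, Fintype.card_fin, nsmul_eq_mul]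
  linarith

/-- Eigenvalues in `[-K, x]` lie at distance at least `ε` from both ends of `[-2K, x + ε]`, since `ε
≤ K`; those below `-K` are paid for by Chebyshev's inequality. The left endpoint is finite because
the comparison of Cauchy masses loses a factor equal to the length of the interval. -/
theorem empiricalSpectralCDF_le_cauchyMass (hA : A.IsSymm) {K ε v x : ℝ} (hv : 0 < v)
    (hε : 0 ≤ ε) (hεK : ε ≤ K) (hK : 0 < K) (hx : |x| ≤ K) :
    empiricalSpectralCDF A x
      ≤ cauchyMass (-(2 * K)) (x + ε) v A + meanSquare A / K ^ 2 + cauchyTail ε v := by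
  obtain ⟨μ, h1, h2, h3⟩ := exists_eigenvalues hA
  rw [h1, cauchyMass_eq hv _ _ h2, meanSquare, ← h3, mul_div_assoc, Finset.sum_div, ← mul_add,
    ← Finset.sum_add_distrib]
  refine (inv_mul_sum_le_of_forall_le fun i => ?_).trans
    (inv_mul_sum_add_const_le _ (cauchyTail_nonneg ε v))
  rw [abs_le] at hx
  have hk := cauchyKernel_nonneg (a := -(2 * K)) (b := x + ε) (by linarith [hx.1]) hv (μ i)
  have hq : 0 ≤ μ i ^ 2 / K ^ 2 := by positivity
  have ht := cauchyTail_nonneg ε v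
  split_ifs with h
  · by_cases hμ : -K ≤ μ i
    · have := one_sub_cauchyTail_le (a := -(2 * K)) (b := x + ε) (ε := ε) (t := μ i) hv
        (by linarith) (by linarith)
      linarith
    · have : 1 ≤ μ i ^ 2 / K ^ 2 := by
        rw [le_div_iff₀ (by positivity)]
        nlinarith
      linarith
  · linarith

theorem cauchyMass_le_empiricalSpectralCDF (hA : A.IsSymm) (a : ℝ) {ε v x : ℝ} (hv : 0 < v) :
    cauchyMass a (x + ε) v A ≤ empiricalSpectralCDF A (x + 2 * ε) + cauchyTail ε v := by
  obtain ⟨μ, h1, h2, -⟩ := exists_eigenvalues hA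
  rw [h1, cauchyMass_eq hv _ _ h2]
  refine (inv_mul_sum_le_of_forall_le fun i => ?_).trans
    (inv_mul_sum_add_const_le _ (cauchyTail_nonneg ε v))
  split_ifs with h
  · linarith [cauchyKernel_le_one a (x + ε) (v := v) (μ i), cauchyTail_nonneg ε v]
  · rw [zero_add]
    exact cauchyKernel_le_cauchyTail hv (by linarith)

theorem empiricalSpectralCDF_le_of_lt_neg (hA : A.IsSymm) {K x : ℝ} (hK : 0 < K) (hx : x < -K) :
    empiricalSpectralCDF A x ≤ meanSquare A / K ^ 2 := by
  obtain ⟨μ, h1, -, h3⟩ := exists_eigenvalues hA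
  rw [h1, meanSquare, ← h3, mul_div_assoc, Finset.sum_div]
  refine inv_mul_sum_le_of_forall_le fun i => ?_
  split_ifs with h
  · rw [le_div_iff₀ (by positivity)]
    nlinarith
  · positivity

theorem one_sub_le_empiricalSpectralCDF (hn : 0 < n) (hA : A.IsSymm) {K x : ℝ} (hK : 0 < K)
    (hx : K < x) : 1 ≤ empiricalSpectralCDF A x + meanSquare A / K ^ 2 := by
  obtain ⟨μ, h1, -, h3⟩ := exists_eigenvalues hA
  rw [h1, meanSquare, ← h3, mul_div_assoc, Finset.sum_div, ← mul_add, ← Finset.sum_add_distrib]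
  have hn' : (n : ℝ) ≠ 0 := by exact_mod_cast hn.ne'
  have : (1 : ℝ) = (n : ℝ)⁻¹ * ∑ _i : Fin n, 1 := by simp [hn']
  refine this.trans_le (inv_mul_sum_le_of_forall_le fun i => ?_)
  split_ifs with h
  · linarith [(by positivity : 0 ≤ μ i ^ 2 / K ^ 2)]
  · rw [zero_add, le_div_iff₀ (by positivity)]
    nlinarith

theorem empiricalSpectralCDF_mem_Icc (hA : A.IsSymm) (x : ℝ) :
    empiricalSpectralCDF A x ∈ Set.Icc 0 1 := by
  obtain ⟨μ, h1, -, -⟩ := exists_eigenvalues hA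
  rw [h1]
  constructor
  · exact mul_nonneg (by positivity) (Finset.sum_nonneg fun i _ => by split_ifs <;> norm_num)
  · have h : ∑ i, (if μ i ≤ x then (1 : ℝ) else 0) ≤ ∑ _i : Fin n, 1 :=
      Finset.sum_le_sum fun i _ => by split_ifs <;> norm_num
    refine (mul_le_mul_of_nonneg_left h (by positivity)).trans ?_
    simpa using inv_mul_le_one (a := (n : ℝ))

end Spectral

/-! ### Expected distribution functions -/

section Expectation

variable {Ω : Type*} [MeasurableSpace Ω] {P : Measure Ω} {n : ℕ}
  {X Y : Ω → Matrix (Fin n) (Fin n) ℝ} {σ : Fin n → Fin n → ℝ}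

theorem IsCenteredSymmetric.integrable_meanSquare (hX : IsCenteredSymmetric P X σ) :
    Integrable (fun ω => meanSquare (X ω)) P :=
  (integrable_finsetSum _ fun i _ => integrable_finsetSum _ fun j _ =>
    (hX.memLp_two i j).integrable_sq).const_mul _

theorem IsCenteredSymmetric.integral_meanSquare (hX : IsCenteredSymmetric P X σ) :
    ∫ ω, meanSquare (X ω) ∂P = meanVariance σ := by
  simp only [meanSquare, meanVariance]
  rw [integral_const_mul, integral_finsetSum _ fun i _ => integrable_finsetSum _ fun j _ =>
    (hX.memLp_two i j).integrable_sq]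
  congr 1
  refine Finset.sum_congr rfl fun i _ => ?_
  rw [integral_finsetSum _ fun j _ => (hX.memLp_two i j).integrable_sq]
  exact Finset.sum_congr rfl fun j _ => hX.second_moment i j

variable [IsProbabilityMeasure P]

theorem IsCenteredSymmetric.integrable_empiricalSpectralCDF (hX : IsCenteredSymmetric P X σ)
    (x : ℝ) : Integrable (fun ω => empiricalSpectralCDF (X ω) x) P := by
  have hm : Measurable fun ω => empiricalSpectralCDF (X ω) x := by
    have := (measurable_empiricalSpectralCDF (n := n) x).comp hX.measurable_upperEntries
    simpa only [Function.comp_def, symmetricMatrix_upperEntries hX.symm] using this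
  refine Integrable.of_bound hm.aestronglyMeasurable 1 (.of_forall fun ω => ?_)
  have h := empiricalSpectralCDF_mem_Icc (hX.symm ω) x
  rw [Real.norm_eq_abs, abs_of_nonneg h.1]
  exact h.2

theorem IsCenteredSymmetric.expectedSpectralCDF_mem_Icc (hX : IsCenteredSymmetric P X σ) (x : ℝ) :
    expectedSpectralCDF P X x ∈ Set.Icc 0 1 := by
  refine ⟨integral_nonneg fun ω => (empiricalSpectralCDF_mem_Icc (hX.symm ω) x).1, ?_⟩
  have h := integral_mono (hX.integrable_empiricalSpectralCDF x) (integrable_const (1 : ℝ))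
    fun ω => (empiricalSpectralCDF_mem_Icc (hX.symm ω) x).2
  rw [integral_const, probReal_univ, one_smul] at h
  exact h

theorem IsCenteredSymmetric.integrable_imStieltjes_line (hX : IsCenteredSymmetric P X σ) {v : ℝ}
    (hv : 0 < v) (a b : ℝ) :
    Integrable (Function.uncurry fun (u : ℝ) ω => imStieltjes (u + v * Complex.I) (X ω))
      ((volume.restrict (Set.uIoc a b)).prod P) := by
  have hm : Measurable (Function.uncurry fun (u : ℝ) ω => imStieltjes (u + v * Complex.I) (X ω)) := by
    have := (continuous_imStieltjes_line (n := n) hv).measurable.comp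
      ((hX.measurable_upperEntries.comp measurable_snd).prodMk
        (measurable_fst : Measurable (Prod.fst : ℝ × Ω → ℝ)))
    simpa only [Function.comp_def, Function.uncurry_def, symmetricMatrix_upperEntries hX.symm]
      using this
  have : IsFiniteMeasure (volume.restrict (Set.uIoc a b)) :=
    ⟨by rw [Measure.restrict_apply_univ, Set.uIoc, Real.volume_Ioc]; exact ENNReal.ofReal_lt_top⟩
  refine Integrable.of_bound hm.aestronglyMeasurable v⁻¹ (.of_forall fun q => ?_)
  have := abs_imStieltjes_le (z := q.1 + v * Complex.I) (by simpa using hv) (hX.symm q.2)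
  simpa [Function.uncurry_def] using this

theorem IsCenteredSymmetric.integrable_cauchyMass (hX : IsCenteredSymmetric P X σ) {v : ℝ}
    (hv : 0 < v) (a b : ℝ) : Integrable (fun ω => cauchyMass a b v (X ω)) P := by
  have hm : Measurable fun ω => cauchyMass a b v (X ω) := by
    have := (continuous_cauchyMass (n := n) hv a b).measurable.comp hX.measurable_upperEntries
    simpa only [Function.comp_def, symmetricMatrix_upperEntries hX.symm] using this
  refine Integrable.of_bound hm.aestronglyMeasurable (Real.pi⁻¹ * (v⁻¹ * |b - a|))
    (.of_forall fun ω => ?_)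
  rw [cauchyMass, norm_mul, Real.norm_of_nonneg (by positivity : 0 ≤ Real.pi⁻¹)]
  refine mul_le_mul_of_nonneg_left (intervalIntegral.norm_integral_le_of_norm_le_const
    fun u _ => ?_) (by positivity)
  have := abs_imStieltjes_le (z := u + v * Complex.I) (by simpa using hv) (hX.symm ω)
  simpa using this

theorem IsCenteredSymmetric.integral_cauchyMass (hX : IsCenteredSymmetric P X σ) {v : ℝ}
    (hv : 0 < v) (a b : ℝ) :
    ∫ ω, cauchyMass a b v (X ω) ∂P
      = Real.pi⁻¹ * ∫ u in a..b, ∫ ω, imStieltjes (u + v * Complex.I) (X ω) ∂P := by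
  rw [intervalIntegral_integral_swap (hX.integrable_imStieltjes_line hv a b), ← integral_const_mul]
  rfl

theorem abs_integral_cauchyMass_sub_le (hX : IsCenteredSymmetric P X σ)
    (hY : IsCenteredSymmetric P Y σ) {v ρ : ℝ} (hv : 0 < v)
    (h : ∀ z : ℂ, z.im = v →
      |∫ ω, imStieltjes z (X ω) ∂P - ∫ ω, imStieltjes z (Y ω) ∂P| ≤ ρ) (a b : ℝ) :
    |∫ ω, cauchyMass a b v (X ω) ∂P - ∫ ω, cauchyMass a b v (Y ω) ∂P| ≤ ρ * |b - a| := by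
  have iX : IntervalIntegrable (fun u : ℝ => ∫ ω, imStieltjes (u + v * Complex.I) (X ω) ∂P)
      volume a b :=
    intervalIntegrable_iff.2 (hX.integrable_imStieltjes_line hv a b).integral_prod_left
  have iY : IntervalIntegrable (fun u : ℝ => ∫ ω, imStieltjes (u + v * Complex.I) (Y ω) ∂P)
      volume a b :=
    intervalIntegrable_iff.2 (hY.integrable_imStieltjes_line hv a b).integral_prod_left
  rw [hX.integral_cauchyMass hv, hY.integral_cauchyMass hv, ← mul_sub,
    ← intervalIntegral.integral_sub iX iY, abs_mul, abs_of_nonneg (by positivity : 0 ≤ Real.pi⁻¹)]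
  have h1 := intervalIntegral.norm_integral_le_of_norm_le_const (a := a) (b := b) (C := ρ)
    (f := fun u : ℝ => ∫ ω, imStieltjes (u + v * Complex.I) (X ω) ∂P
      - ∫ ω, imStieltjes (u + v * Complex.I) (Y ω) ∂P) fun u _ => h _ (by simp)
  refine (mul_le_mul_of_nonneg_right (inv_le_one_of_one_le₀ ?_) (abs_nonneg _)).trans
    ((one_mul _).trans_le h1)
  linarith [Real.pi_gt_three]

/-- Comparison of expected spectral distribution functions through Cauchy smoothing. -/
theorem expectedSpectralCDF_le (hn : 0 < n) (hX : IsCenteredSymmetric P X σ)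
    (hY : IsCenteredSymmetric P Y σ) {v ρ ε K : ℝ} (hv : 0 < v) (hε : 0 ≤ ε) (hεK : ε ≤ K)
    (hK : 0 < K) (h : ∀ z : ℂ, z.im = v →
      |∫ ω, imStieltjes z (X ω) ∂P - ∫ ω, imStieltjes z (Y ω) ∂P| ≤ ρ) (x : ℝ) :
    expectedSpectralCDF P X x ≤ expectedSpectralCDF P Y (x + 2 * ε)
      + (meanVariance σ / K ^ 2 + 2 * cauchyTail ε v + 4 * K * ρ) := by
  have hρ : 0 ≤ ρ := (abs_nonneg _).trans (h (v * Complex.I) (by simp))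
  have ht := cauchyTail_nonneg ε v
  have hs : 0 ≤ meanVariance σ / K ^ 2 := div_nonneg (meanVariance_nonneg σ) (sq_nonneg K)
  have hKρ : 0 ≤ 4 * K * ρ := by positivity
  have hX1 := hX.expectedSpectralCDF_mem_Icc x
  have hY1 := hY.expectedSpectralCDF_mem_Icc (x + 2 * ε)
  have iX := hX.integrable_empiricalSpectralCDF x
  have iY := hY.integrable_empiricalSpectralCDF (x + 2 * ε)
  have mX := hX.integrable_meanSquare.div_const (K ^ 2)
  have mY := hY.integrable_meanSquare.div_const (K ^ 2)
  have vX : ∫ ω, meanSquare (X ω) / K ^ 2 ∂P = meanVariance σ / K ^ 2 := by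
    rw [integral_div, hX.integral_meanSquare]
  have vY : ∫ ω, meanSquare (Y ω) / K ^ 2 ∂P = meanVariance σ / K ^ 2 := by
    rw [integral_div, hY.integral_meanSquare]
  -- Outside `[-K, K]` Chebyshev's inequality alone suffices: the left side is nearly `0`, or the
  -- right side nearly `1`. Smoothing is needed only in between.
  rcases lt_or_ge x (-K) with hx | hx
  · have h1 := integral_mono iX mX fun ω => empiricalSpectralCDF_le_of_lt_neg (hX.symm ω) hK hx
    rw [vX] at h1
    have := hY1.1
    unfold expectedSpectralCDF at *
    linarith
  rcases lt_or_ge K x with hx' | hx'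
  · have h1 := integral_mono (integrable_const (1 : ℝ)) (iY.add mY) fun ω =>
      one_sub_le_empiricalSpectralCDF hn (hY.symm ω) hK (x := x + 2 * ε) (by linarith)
    rw [integral_add' iY mY, vY] at h1
    simp only [integral_const, probReal_univ, one_smul] at h1
    have := hX1.2
    unfold expectedSpectralCDF at *
    linarith
  · have hxK : |x| ≤ K := abs_le.2 ⟨hx, hx'⟩
    have cX := hX.integrable_cauchyMass hv (-(2 * K)) (x + ε)
    have cY := hY.integrable_cauchyMass hv (-(2 * K)) (x + ε)
    have h1 := integral_mono iX ((cX.add mX).add (integrable_const (cauchyTail ε v))) fun ω =>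
      empiricalSpectralCDF_le_cauchyMass (hX.symm ω) hv hε hεK hK hxK
    rw [integral_add' (cX.add mX) (integrable_const _), integral_add' cX mX, vX] at h1
    have h2 := integral_mono cY (iY.add (integrable_const (cauchyTail ε v))) fun ω =>
      cauchyMass_le_empiricalSpectralCDF (hY.symm ω) (-(2 * K)) hv
    rw [integral_add' iY (integrable_const _)] at h2
    simp only [integral_const, probReal_univ, one_smul] at h1 h2
    have h3 := (le_abs_self _).trans
      (abs_integral_cauchyMass_sub_le hX hY hv h (-(2 * K)) (x + ε))
    -- The smoothed interval has length at most `4 K`, as `x ≤ K` and `ε ≤ K`.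
    have h4 : ρ * |x + ε - -(2 * K)| ≤ 4 * K * ρ := by
      rw [mul_comm]
      refine mul_le_mul_of_nonneg_right (abs_le.2 ⟨?_, ?_⟩) hρ <;> linarith
    unfold expectedSpectralCDF at *
    linarith

end Expectation

/-! ### Lévy distance and conclusion -/

theorem levyDistance_nonneg (F G : ℝ → ℝ) : 0 ≤ levyDistance F G :=
  Real.sInf_nonneg fun _ h => h.1.le

/-- The lower inequality in the definition is `h1` at `x - ε`. In this symmetric form one comparison
lemma, applied with X and Y in both orders, supplies both hypotheses. -/
theorem levyDistance_le {F G : ℝ → ℝ} {ε : ℝ} (hε : 0 < ε) (h1 : ∀ x, F x ≤ G (x + ε) + ε)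
    (h2 : ∀ x, G x ≤ F (x + ε) + ε) : levyDistance F G ≤ ε := by
  refine csInf_le ⟨0, fun _ h => h.1.le⟩ ⟨hε, fun x => ⟨?_, h2 x⟩⟩
  have := h1 (x - ε)
  rw [sub_add_cancel] at this
  linarith

end

theorem theorem3 {Ω : Type*} [MeasurableSpace Ω] (P : Measure Ω) [IsProbabilityMeasure P]
    (σ : (n : ℕ) → Fin n → Fin n → ℝ)
    (X Y : (n : ℕ) → Ω → Matrix (Fin n) (Fin n) ℝ)
    (hX : ∀ n, IsCenteredSymmetric P (X n) (σ n))
    (hY : ∀ n, IsCenteredSymmetric P (Y n) (σ n))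
    (hXY : ∀ n, IndepFun (fun ω (p : Fin n × Fin n) => X n ω p.1 p.2)
      (fun ω (p : Fin n × Fin n) => Y n ω p.1 p.2) P)
    (hX_mart : ∀ n, MartingaleCondition P (X n))
    (hX_var : Tendsto (fun n => condVarianceDefect P (X n) (σ n)) atTop (𝓝 0))
    (hX_lind : ∀ τ : ℝ, 0 < τ → Tendsto (fun n => lindebergRatio P (X n) τ) atTop (𝓝 0))
    (hY_gauss : ∀ n, HasIndepGaussianEntries P (Y n))
    (hY_lind : ∀ τ : ℝ, 0 < τ → Tendsto (fun n => lindebergRatio P (Y n) τ) atTop (𝓝 0))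
    (hσ : Tendsto (fun n : ℕ => 1 / (n : ℝ) * ∑ i, |rowVariance (σ n) i - 1|) atTop (𝓝 0)) :
    Tendsto (fun n => levyDistance (expectedSpectralCDF P (X n)) (expectedSpectralCDF P (Y n)))
      atTop (𝓝 0) := by
  have hvar : ∀ᶠ n in atTop, meanVariance (σ n) ≤ 2 := by
    filter_upwards [hσ.eventually_lt_const one_pos, eventually_gt_atTop 0] with n h hn
    linarith [meanVariance_le hn (σ n)]
  have hst : ∀ v : ℝ, 0 < v → ∀ ρ : ℝ, 0 < ρ → ∀ᶠ n in atTop, ∀ z : ℂ, z.im = v →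
      |∫ ω, imStieltjes z (X n ω) ∂P - ∫ ω, imStieltjes z (Y n ω) ∂P| ≤ ρ := by
    intro v hv ρ hρ
    -- With the mean variance at most 2, this makes the truncation term `16 v⁻⁴ τ * 2` equal to `ρ /
    -- 2`.
    set τ : ℝ := ρ / (64 * v⁻¹ ^ 4) with hτ
    have hτ0 : 0 < τ := by positivity
    have hlim : Tendsto (fun n => 8 * v⁻¹ ^ 3 * (condVarianceDefect P (X n) (σ n)
        + lindebergRatio P (X n) τ + lindebergRatio P (Y n) τ)) atTop (𝓝 0) := by
      simpa only [add_zero, mul_zero] using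
        ((hX_var.add (hX_lind τ hτ0)).add (hY_lind τ hτ0)).const_mul (8 * v⁻¹ ^ 3)
    filter_upwards [hvar, hlim.eventually_lt_const (half_pos hρ), eventually_gt_atTop 0]
      with n h1 h2 hn z hz
    have h3 := abs_integral_imStieltjes_sub_le (hX n) (hY n) (hXY n) (hX_mart n) (hY_gauss n) hn
      (z := z) (by rw [hz]; exact hv) hτ0.le
    rw [hz] at h3
    have h4 : 16 * v⁻¹ ^ 4 * τ * meanVariance (σ n) ≤ 16 * v⁻¹ ^ 4 * τ * 2 :=
      mul_le_mul_of_nonneg_left h1 (by positivity)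
    have h5 : 16 * v⁻¹ ^ 4 * τ * 2 = ρ / 2 := by
      rw [hτ]
      field_simp
      norm_num
    linarith
  refine tendsto_order.2 ⟨fun a ha => .of_forall fun n => ha.trans_le (levyDistance_nonneg _ _),
    fun a ha => ?_⟩
  set ε : ℝ := a / 2 with hε
  have hε0 : 0 < ε := half_pos ha
  -- The order of choices is `K`, then `v`, then `ρ = ε / (16 K)`. Second moment, Cauchy tails and
  -- Stieltjes error each contribute at most `ε / 4`; the smoothing radius is `ε / 2` because the
  -- comparison shifts by twice the radius.
  obtain ⟨K, hK0, hKε, hK⟩ : ∃ K : ℝ, 0 < K ∧ ε / 2 ≤ K ∧ 2 / K ^ 2 ≤ ε / 4 := by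
    refine ⟨8 / ε + ε + 1, by positivity, ?_, ?_⟩
    · have : 0 < 8 / ε := by positivity
      linarith
    · have h1 : 0 < 8 / ε := by positivity
      have h2 : 8 / ε ≤ (8 / ε + ε + 1) ^ 2 := by nlinarith
      rw [div_le_iff₀ (by positivity)]
      calc (2 : ℝ) = ε / 4 * (8 / ε) := by field_simp; norm_num
        _ ≤ _ := mul_le_mul_of_nonneg_left h2 (by positivity)
  obtain ⟨v, hvt, hv0⟩ := (((tendsto_cauchyTail (half_pos hε0)).eventually_lt_const
    (by positivity : 0 < ε / 8)).and self_mem_nhdsWithin).exists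
  have hv : 0 < v := hv0
  filter_upwards [hvar, hst v hv (ε / (16 * K)) (by positivity), eventually_gt_atTop 0]
    with n h1 h2 hn
  have h3 : meanVariance (σ n) / K ^ 2 + 2 * cauchyTail (ε / 2) v + 4 * K * (ε / (16 * K)) ≤ ε := by
    have e1 : meanVariance (σ n) / K ^ 2 ≤ 2 / K ^ 2 := by gcongr
    have e2 : 4 * K * (ε / (16 * K)) = ε / 4 := by
      field_simp
      norm_num
    linarith
  have hc : ε < a := half_lt_self ha
  refine (levyDistance_le hε0 (fun x => ?_) fun x => ?_).trans_lt hc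
  · have := expectedSpectralCDF_le hn (hX n) (hY n) hv (half_pos hε0).le hKε hK0 h2 x
    rw [mul_div_cancel₀ _ two_ne_zero] at this
    linarith
  · have := expectedSpectralCDF_le hn (hY n) (hX n) hv (half_pos hε0).le hKε hK0
      (fun z hz => by rw [abs_sub_comm]; exact h2 z hz) x
    rw [mul_div_cancel₀ _ two_ne_zero] at this
    linarith
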